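/- There are an absolute constant $c\in\mathbb{N}$ and absolute polynomials $p\in\mathbb{N}[X_1,X_2,X_3,X_4]$ and $q\in\mathbb{N}[X]$ such that the following holds. Conventions. An algebraic circuit over a field $\mathbb{F}$ is a directed acyclic graph whose leaves are labelled by variables or constants from $\mathbb{F}$ and whose internal nodes are sum or product gates of unbounded fan-in; its size is the number of edges and its depth is the length of a longest directed path. $\log$ is the logarithm to base $2$. For integers $n,\sigma,\mu,\rho\ge 0$, a family $\mathcal{S}=(S_1,\dots,S_n)$ of subsets of $\{1,\dots,\mu\}$ is an $(n,\sigma,\mu,\rho)$-design if $|S_i|=\sigma$ for all $i$ and $|S_i\cap S_j|<\rho$ for all $i\ne j$. For a polynomial $g$ in $\sigma$ variables, $\mathbf{KI}_{g,\mathcal{S}}(\mathbf{w})=(g(\mathbf{w}_{S_1}),\dots,g(\mathbf{w}_{S_n}))$, where $\mathbf{w}=(w_1,\dots,w_\mu)$ and $\mathbf{w}_{S_i}$ is the tuple of the $w_j$ with $j\in S_i$, in increasing order of $j$. For a polynomial $A(T,\mathbf{x},z)$, $A \text{ trunc } T^k$ is obtained from $A$ by discarding all monomials of $T$-degree at least $k$.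 Let $\mathbb{F}$ be a field of characteristic zero, $n\ge 2$, $\mathbf{x}=(x_1,\dots,x_n)$, $k>1$ and $\ell\ge 0$ integers, and let $P\in\mathbb{F}[T,\mathbf{x},z]$ and $R_1,\dots,R_\ell\in\mathbb{F}[T,\mathbf{x}]$ satisfy: - $P$ is computed by a circuit of depth at most $\Delta$ and size at most $s$; - $P$ is $T$-regularized, i.e. every monomial of $P$ that depends on $\mathbf{x}$ is divisible by $T$, and $P$ is monic in $z$, i.e. the coefficient in $\mathbb{F}[T,\mathbf{x}]$ of the highest power of $z$ in $P$ is a nonzero constant from $\mathbb{F}$; - each $R_i$ is a truncated, non-degenerate, approximate $z$-root of $P$ of order $k$, i.e. $\deg_T R_i<k$, $(\partial_z P)(0,\mathbf{0},R_i(0,\mathbf{0}))\ne 0$ and $P(T,\mathbf{x},R_i(T,\mathbf{x}))\equiv 0 \bmod T^k$. Let $Q(T,\mathbf{x},z)=\left(\prod_{i=1}^{\ell}(z-R_i(T,\mathbf{x}))\right)\text{ trunc } T^k$, let $g\in\mathbb{F}[y_1,\dots,y_\sigma]$ have total degree $d$ (with $d=0$ if $g=0$), let $\mathcal{S}$ be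 an $(n,\sigma,\mu,\rho)$-design, and put $$ s' = p(s,\ell,k,\deg P)\cdot(\rho\log k)^{q(d)}. $$ 1. If $Q(T,\mathbf{x},z)$ does not divide $P(T,\mathbf{x},z)$ in $\mathbb{F}[T,\mathbf{x},z]$ but $Q(T,\mathbf{KI}_{g,\mathcal{S}}(\mathbf{w}),z)$ divides $P(T,\mathbf{KI}_{g,\mathcal{S}}(\mathbf{w}),z)$ in $\mathbb{F}[T,\mathbf{w},z]$, then $g$ is computed by an algebraic circuit over $\mathbb{F}$ of depth at most $c\,\Delta$ and size at most $s'$. 2. In particular, if every circuit of depth at most $c\,\Delta$ that computes $g$ has size greater than $s'$, then $Q(T,\mathbf{x},z)$ divides $P(T,\mathbf{x},z)$ if and only if $Q(T,\mathbf{KI}_{g,\mathcal{S}}(\mathbf{w}),z)$ divides $P(T,\mathbf{KI}_{g,\mathcal{S}}(\mathbf{w}),z)$. -/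

import Mathlib

/-! Algebraic circuits -/

/-- The label of a node of an algebraic circuit over `F` in the variables `V`: a leaf is a variable
or a constant, an internal node is a sum or a product gate. The multiset `inputs` lists the
tails of the incoming edges (parallel edges allowed, fan-in unbounded). A gate without inputs
is the same thing as the leaf `0`, respectively `1`. -/
inductive CircuitGate (F V N : Type*) where
  | var (v : V)
  | const (a : F)
  | add (inputs : Multiset N)
  | mul (inputs : Multiset N)

/-- The multiset of nodes that feed into a gate. -/
def CircuitGate.inputs {F V N : Type*} : CircuitGate F V N → Multiset N
  | .var _ => 0
  | .const _ => 0
  | .add s => s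
  | .mul s => s

/-- An algebraic circuit over `F` in the variables `V`: a finite directed acyclic graph whose nodes
carry gates, with a designated output node. -/
structure AlgCircuit (F V : Type*) where
  Node : Type
  fintypeNode : Fintype Node
  gate : Node → CircuitGate F V Node
  acyclic : WellFounded (fun a b : Node => a ∈ (gate b).inputs)
  out : Node

namespace AlgCircuit

variable {F V : Type*}

/-- The polynomial computed at a node. -/
noncomputable def value [CommSemiring F] (C : AlgCircuit F V) : C.Node → MvPolynomial V F :=
  C.acyclic.fix fun v rec =>
    match h : C.gate v with
    | .var x => MvPolynomial.X x
    | .const a => MvPolynomial.C a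
    | .add s => (s.attach.map fun u => rec u.1 (by rw [h]; exact u.2)).sum
    | .mul s => (s.attach.map fun u => rec u.1 (by rw [h]; exact u.2)).prod

/-- The length of the longest directed path that ends in a node. -/
noncomputable def nodeDepth (C : AlgCircuit F V) : C.Node → ℕ :=
  C.acyclic.fix fun v rec => ((C.gate v).inputs.attach.map fun u => rec u.1 u.2 + 1).sup

/-- The polynomial computed by a circuit. -/
noncomputable def polynomial [CommSemiring F] (C : AlgCircuit F V) : MvPolynomial V F :=
  C.value C.out

/-- The depth of a circuit: the length of its longest directed path. -/
noncomputable def depth (C : AlgCircuit F V) : ℕ :=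
  (@Finset.univ C.Node C.fintypeNode).sup C.nodeDepth

/-- The size of a circuit: the number of its edges. -/
def size (C : AlgCircuit F V) : ℕ :=
  ∑ v ∈ @Finset.univ C.Node C.fintypeNode, Multiset.card (C.gate v).inputs

theorem value_eq [CommSemiring F] (C : AlgCircuit F V) (v : C.Node) :
    C.value v = match C.gate v with
      | .var x => MvPolynomial.X x
      | .const a => MvPolynomial.C a
      | .add s => (s.map C.value).sum
      | .mul s => (s.map C.value).prod := by
  rw [value, WellFounded.fix_eq]
  split <;> rename_i h <;> simp only [h]
  · exact congrArg Multiset.sum (Multiset.attach_map_val' _ C.value)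
  · exact congrArg Multiset.prod (Multiset.attach_map_val' _ C.value)

theorem nodeDepth_eq (C : AlgCircuit F V) (v : C.Node) :
    C.nodeDepth v = ((C.gate v).inputs.map fun u => C.nodeDepth u + 1).sup := by
  rw [nodeDepth, WellFounded.fix_eq]
  exact congrArg Multiset.sup (Multiset.attach_map_val' _ fun u => C.nodeDepth u + 1)

end AlgCircuit

/-! Polynomials in `T`, `x`, `z`

For a set `V` of variables `x`, the ring `F[T, x]` is `MvPolynomial (Option V) F`, where `none` is
`T`; the ring `F[T, x, z]` is `MvPolynomial (Option (Option V)) F`, where `none` is `z`,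
`some none` is `T` and `some (some i)` is `x_i`. -/

section TXZ

variable {F V : Type*} [Field F]

/-- `P(T, x, z)` as a univariate polynomial in `z` over `F[T, x]`. -/
noncomputable def asPolyInZ (P : MvPolynomial (Option (Option V)) F) :
    Polynomial (MvPolynomial (Option V) F) :=
  MvPolynomial.optionEquivLeft F (Option V) P

/-- `P` is monic in `z`: the coefficient of the highest power of `z` is a nonzero field constant. -/
def IsMonicInZ (P : MvPolynomial (Option (Option V)) F) : Prop :=
  ∃ c : F, c ≠ 0 ∧ (asPolyInZ P).leadingCoeff = MvPolynomial.C c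

/-- `P` is `T`-regularized: `P(0, x, z)` lies in `F[z]`, that is, every monomial of `P` that
depends on `x` is divisible by `T`. -/
def IsTRegularized (P : MvPolynomial (Option (Option V)) F) : Prop :=
  ∀ m ∈ P.support, (∃ i : V, m (some (some i)) ≠ 0) → m (some none) ≠ 0

/-- `R(T, x)` is an approximate `z`-root of `P` of order `k`: `P(T, x, R(T, x)) = 0` mod `T ^ k`. -/
def IsApproxRoot (P : MvPolynomial (Option (Option V)) F) (R : MvPolynomial (Option V) F)
    (k : ℕ) : Prop :=
  (MvPolynomial.X none : MvPolynomial (Option V) F) ^ k ∣ (asPolyInZ P).eval R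

/-- `R` is truncated (with respect to the order `k`): its degree in `T` is less than `k`. -/
def IsTruncated (R : MvPolynomial (Option V) F) (k : ℕ) : Prop :=
  R.degreeOf none < k

/-- `R` is non-degenerate for `P`: `(∂P/∂z)(0, 0, α) ≠ 0`, where `α = R(0, 0)`. -/
def IsNondegenerate (P : MvPolynomial (Option (Option V)) F) (R : MvPolynomial (Option V) F) :
    Prop :=
  MvPolynomial.eval
    (fun v : Option (Option V) => v.elim (MvPolynomial.constantCoeff R) fun _ => 0)
    (MvPolynomial.pderiv none P) ≠ 0

/-- `Q trunc T ^ k`: discard all the monomials of `Q(T, x, z)` whose degree in `T` is at least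
`k`. -/
noncomputable def truncT (Q : MvPolynomial (Option (Option V)) F) (k : ℕ) :
    MvPolynomial (Option (Option V)) F :=
  ∑ m ∈ Q.support with m (some none) < k, MvPolynomial.monomial m (MvPolynomial.coeff m Q)

/-- `(∏ i, (z - R_i(T, x))) trunc T ^ k`. -/
noncomputable def truncRootProduct {l : ℕ} (R : Fin l → MvPolynomial (Option V) F) (k : ℕ) :
    MvPolynomial (Option (Option V)) F :=
  truncT (∏ i, (MvPolynomial.X none - MvPolynomial.rename some (R i))) k

/-- `P(T, h(w), z)`: each variable `x_i` is replaced by the polynomial `h_i(w)`. -/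
noncomputable def substX {W : Type*} (h : V → MvPolynomial W F)
    (P : MvPolynomial (Option (Option V)) F) : MvPolynomial (Option (Option W)) F :=
  MvPolynomial.aeval
    (fun v : Option (Option V) => match v with
      | none => MvPolynomial.X none
      | some none => MvPolynomial.X (some none)
      | some (some i) => MvPolynomial.rename (fun j : W => some (some j)) (h i)) P

end TXZ

/-! Designs and the Kabanets–Impagliazzo generator -/

/-- `S_1, …, S_n ⊆ [μ]` is an `(n, σ, μ, ρ)`-design. -/
structure IsDesign (n σ μ ρ : ℕ) (S : Fin n → Finset (Fin μ)) : Prop where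
  card_eq : ∀ i, (S i).card = σ
  card_inter_lt : ∀ i j, i ≠ j → (S i ∩ S j).card < ρ

/-- The Kabanets–Impagliazzo generator `w ↦ (g(w_{S_1}), …, g(w_{S_n}))`, as a tuple of polynomials
in `w`. The elements of each `S_i` are taken in increasing order. -/
noncomputable def kiGenerator {F : Type*} [Field F] {n σ μ ρ : ℕ} (g : MvPolynomial (Fin σ) F)
    (S : Fin n → Finset (Fin μ)) (hS : IsDesign n σ μ ρ S) (i : Fin n) :
    MvPolynomial (Fin μ) F :=
  MvPolynomial.rename ((S i).orderEmbOfFin (hS.card_eq i)) g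

/-! A failure of the generator is turned into a circuit for its seed `g`. Only a bounded number of
operations is used; each adds a constant to the depth and enlarges size and degree polynomially,
because gates have unbounded fan-in and coefficients are extracted by interpolation (characteristic
zero). `GradedLeaves.Easy` does this bookkeeping.

The main tool is a closed formula for roots. Suppose `f = (z - r)^m q` with `T ∣ r`, and `f(0, z) =
z^m v(z)` has constant coefficients and `v(0) ≠ 0`. Expanding in powers of `r / z`, the coefficient
of `z⁻¹` in `z f' / f` is `m r`. Modulo `T^K` the inverse of `f` is a finite geometric series around
`f(0, z)`, so `m r` is one `z`-coefficient of an explicit expression in `f` (`coeff_residue_sum`,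
`GradedLeaves.Easy.root`). There is no iteration, so the depth grows by a constant only, and
multiple roots are allowed.

The formula is used twice. With `m = 1` it shows that the roots `R_i`, and hence `Q`, are easy.
Divisibility of `P` by the monic `Q` means that certain coefficients of the quotient of the reversed
polynomials vanish (`Polynomial.Monic.dvd_iff_coeff_reflect`). As `Q` does not divide `P`, one of
them gives a nonzero easy `f(x)`; if the substituted `Q` divides the substituted `P`, then `f`
vanishes at the generator (`exists_easy_of_not_dvd`).

A hybrid argument then yields an index `i` such that `p(z) = f(b_1, …, b_{i-1}, z, x_{i+1}, …, x_n)`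
is nonzero with root `b_i = g(w_{S_i})`. Write `p = (z - b_i)^m q` with `q(b_i) ≠ 0`, choose a point
where `q(b_i)` does not vanish, and move only the `w_u` with `u ∈ S_i` along a line through it. By
the design property every other `b_j` sees fewer than `ρ` moving variables, hence has at most `ρ^d`
monomials, and the restricted `p` is easy. The root formula, now with arbitrary `m`, makes `g` easy.

The depth obtained is `Δ + 157`, which is at most `158 * Δ` unless `Δ = 0`. In that case `P` is a
variable or a constant, and the substitution cannot create divisibility. -/

/-! Circuits over a commutative ring with prescribed leaves -/

/-- The element `a` is computed from the elements of `L` by a circuit of depth at most `δ` whose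
numbers of nodes and of edges add up to at most `N`. -/
def HasCircuit {A : Type*} [CommSemiring A] (L : Set A) (δ N : ℕ) (a : A) : Prop :=
  ∃ (Node : Type) (_ : Fintype Node) (inputs : Node → Multiset Node) (val : Node → A)
    (dep : Node → ℕ) (out : Node),
    val out = a ∧ (∀ v, dep v ≤ δ) ∧ (∀ v, ∀ u ∈ inputs v, dep u < dep v) ∧
    (∀ v, (inputs v = 0 ∧ val v ∈ L) ∨ val v = ((inputs v).map val).sum ∨
      val v = ((inputs v).map val).prod) ∧
    Fintype.card Node + ∑ v, (inputs v).card ≤ N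

namespace HasCircuit

variable {A A' : Type*} [CommSemiring A] [CommSemiring A'] {L : Set A} {L' : Set A'}
  {δ δ' N N' : ℕ} {a : A}

theorem mono (h : HasCircuit L δ N a) (hδ : δ ≤ δ') (hN : N ≤ N') : HasCircuit L δ' N' a := by
  obtain ⟨Node, i, inputs, val, dep, out, h1, h2, h3, h4, h5⟩ := h
  exact ⟨Node, i, inputs, val, dep, out, h1, fun v => (h2 v).trans hδ, h3, h4, h5.trans hN⟩

theorem leaf (h : a ∈ L) : HasCircuit L 0 1 a :=
  ⟨Unit, inferInstance, fun _ => 0, fun _ => a, fun _ => 0, (), rfl, by simp, by simp,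
    fun _ => Or.inl ⟨rfl, h⟩, by simp⟩

theorem map (h : HasCircuit L δ N a) (φ : A →+* A') (hφ : ∀ x ∈ L, φ x ∈ L') :
    HasCircuit L' δ N (φ a) := by
  obtain ⟨Node, i, inputs, val, dep, out, h1, h2, h3, h4, h5⟩ := h
  refine ⟨Node, i, inputs, fun v => φ (val v), dep, out, congrArg φ h1, h2, h3, fun v => ?_, h5⟩
  rcases h4 v with h | h | h
  · exact Or.inl ⟨h.1, hφ _ h.2⟩
  · right; left
    change φ (val v) = _
    rw [h, map_multiset_sum, Multiset.map_map]; rfl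
  · right; right
    change φ (val v) = _
    rw [h, map_multiset_prod, Multiset.map_map]; rfl

/-- Substitution of circuits for the leaves of a circuit. -/
theorem subst (h : HasCircuit L δ N a) (φ : A →+* A')
    (hφ : ∀ x ∈ L, HasCircuit L' δ' N' (φ x)) :
    HasCircuit L' (δ + δ' + 1) (N * (N' + 2)) (φ a) := by
  classical
  obtain ⟨Node, i, inputs, val, dep, out, h1, h2, h3, h4, h5⟩ := h
  let Leaf := {u : Node // inputs u = 0 ∧ val u ∈ L}
  have hc : ∀ u : Leaf, HasCircuit L' δ' N' (φ (val u)) := fun u => hφ _ u.2.2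
  choose M iM inp vl dp ot g1 g2 g3 g4 g5 using hc
  -- Each leaf becomes a sum gate whose single input is the output of its own copy of a circuit.
  -- This accounts for the extra level of depth and for one extra edge per leaf.
  refine ⟨Node ⊕ (Σ u : Leaf, M u), inferInstance,
    Sum.elim (fun v => if hv : inputs v = 0 ∧ val v ∈ L then {Sum.inr ⟨⟨v, hv⟩, ot ⟨v, hv⟩⟩}
      else (inputs v).map Sum.inl)
      (fun x => (inp x.1 x.2).map fun y => Sum.inr ⟨x.1, y⟩),
    Sum.elim (fun v => φ (val v)) (fun x => vl x.1 x.2),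
    Sum.elim (fun v => dep v + δ' + 1) (fun x => dp x.1 x.2), Sum.inl out, by simp [h1], ?_, ?_,
    ?_, ?_⟩
  · rintro (v | x)
    · have := h2 v
      simp only [Sum.elim_inl]; omega
    · have := g2 x.1 x.2
      simp only [Sum.elim_inr]; omega
  · rintro (v | x) u hu
    · by_cases hv : inputs v = 0 ∧ val v ∈ L
      · simp only [Sum.elim_inl, hv, and_self, dite_true, Multiset.mem_singleton] at hu
        subst hu
        have := g2 ⟨v, hv⟩ (ot ⟨v, hv⟩)
        simp only [Sum.elim_inl, Sum.elim_inr]; omega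
      · simp only [Sum.elim_inl, dif_neg hv, Multiset.mem_map] at hu
        obtain ⟨y, hy, rfl⟩ := hu
        have := h3 v y hy
        simp only [Sum.elim_inl]; omega
    · simp only [Sum.elim_inr, Multiset.mem_map] at hu
      obtain ⟨y, hy, rfl⟩ := hu
      exact g3 x.1 x.2 y hy
  · rintro (v | x)
    · by_cases hv : inputs v = 0 ∧ val v ∈ L
      · right; left
        simp [dif_pos hv, g1]
      · right
        simp only [Sum.elim_inl, dif_neg hv, Multiset.map_map, Function.comp_def]
        rcases h4 v with h | h | h
        · exact absurd h hv
        · left; rw [h, map_multiset_sum, Multiset.map_map]; rfl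
        · right; rw [h, map_multiset_prod, Multiset.map_map]; rfl
    · simp only [Sum.elim_inr, Multiset.map_map, Function.comp_def, Multiset.map_eq_zero]
      exact g4 x.1 x.2
  · have e1 : ∑ v : Node, (if hv : inputs v = 0 ∧ val v ∈ L then
        ({Sum.inr ⟨⟨v, hv⟩, ot ⟨v, hv⟩⟩} : Multiset (Node ⊕ (Σ u : Leaf, M u)))
        else (inputs v).map Sum.inl).card ≤ Fintype.card Node + ∑ v, (inputs v).card := by
      rw [← Finset.card_univ, Finset.card_eq_sum_ones, ← Finset.sum_add_distrib]
      refine Finset.sum_le_sum fun v _ => ?_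
      split_ifs <;> simp
    have e2 : (∑ u : Leaf, Fintype.card (M u)) + ∑ u : Leaf, ∑ y : M u, (inp u y).card ≤
        Fintype.card Node * N' := by
      rw [← Finset.sum_add_distrib]
      refine (Finset.sum_le_sum (g := fun _ => N') fun u _ => g5 u).trans ?_
      rw [Finset.sum_const, smul_eq_mul, Finset.card_univ]
      exact Nat.mul_le_mul_right _ (Fintype.card_subtype_le _)
    have e3 : Fintype.card Node * N' ≤ N * N' := Nat.mul_le_mul_right _ (by omega)
    rw [Fintype.sum_sum_type, Fintype.card_sum, Fintype.card_sigma]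
    simp only [Sum.elim_inl, Sum.elim_inr, Multiset.card_map]
    rw [Fintype.sum_sigma]
    simp only
    rw [Nat.mul_add]
    omega

/-- A star with one gate and `s.card` leaves has depth 1 and `2 * s.card + 1` nodes and edges;
`subst` then replaces the leaves by the given circuits. -/
theorem sum {ι : Type*} (s : Finset ι) (f : ι → A) (hf : ∀ i ∈ s, HasCircuit L δ N (f i)) :
    HasCircuit L (δ + 2) ((2 * s.card + 1) * (N + 2)) (∑ i ∈ s, f i) := by
  have h : HasCircuit (f '' s) 1 (2 * s.card + 1) (∑ i ∈ s, f i) := by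
    let e := s.equivFin
    refine ⟨Option (Fin s.card), inferInstance,
      fun o => o.elim (Finset.univ.val.map some) fun _ => 0,
      fun o => o.elim (∑ i ∈ s, f i) fun j => f (e.symm j),
      fun o => o.elim 1 fun _ => 0, none, rfl, ?_, ?_, ?_, ?_⟩
    · rintro (_ | v) <;> simp
    · rintro (_ | v) u hu
      · obtain ⟨y, -, rfl⟩ := Multiset.mem_map.1 (show u ∈ Finset.univ.val.map some from hu)
        simp
      · simp at hu
    · rintro (_ | v)
      · right; left
        simp only [Option.elim, Multiset.map_map, Function.comp_def]
        change _ = ∑ j, f (e.symm j)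
        rw [e.symm.sum_comp (fun i => f i), Finset.sum_coe_sort s f]
      · exact Or.inl ⟨rfl, Set.mem_image_of_mem _ (e.symm v).2⟩
    · rw [Fintype.sum_option]; simp; omega
  refine (h.subst (RingHom.id A) (L' := L) (δ' := δ) (N' := N) ?_).mono (by omega) le_rfl
  rintro _ ⟨i, hi, rfl⟩
  exact hf i hi

theorem prod {ι : Type*} (s : Finset ι) (f : ι → A) (hf : ∀ i ∈ s, HasCircuit L δ N (f i)) :
    HasCircuit L (δ + 2) ((2 * s.card + 1) * (N + 2)) (∏ i ∈ s, f i) := by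
  have h : HasCircuit (f '' s) 1 (2 * s.card + 1) (∏ i ∈ s, f i) := by
    let e := s.equivFin
    refine ⟨Option (Fin s.card), inferInstance,
      fun o => o.elim (Finset.univ.val.map some) fun _ => 0,
      fun o => o.elim (∏ i ∈ s, f i) fun j => f (e.symm j),
      fun o => o.elim 1 fun _ => 0, none, rfl, ?_, ?_, ?_, ?_⟩
    · rintro (_ | v) <;> simp
    · rintro (_ | v) u hu
      · obtain ⟨y, -, rfl⟩ := Multiset.mem_map.1 (show u ∈ Finset.univ.val.map some from hu)
        simp
      · simp at hu
    · rintro (_ | v)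
      · right; right
        simp only [Option.elim, Multiset.map_map, Function.comp_def]
        change _ = ∏ j, f (e.symm j)
        rw [e.symm.prod_comp (fun i => f i), Finset.prod_coe_sort s f]
      · exact Or.inl ⟨rfl, Set.mem_image_of_mem _ (e.symm v).2⟩
    · rw [Fintype.sum_option]; simp; omega
  refine (h.subst (RingHom.id A) (L' := L) (δ' := δ) (N' := N) ?_).mono (by omega) le_rfl
  rintro _ ⟨i, hi, rfl⟩
  exact hf i hi

end HasCircuit

/-! ### Passage between `AlgCircuit` and `HasCircuit` -/

namespace AlgCircuit

variable {F V : Type*}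

/-- The nodes that are not needed for the edges or for the output can be dropped. -/
theorem hasCircuit [CommSemiring F] (C : AlgCircuit F V) :
    HasCircuit (Set.range MvPolynomial.X ∪ Set.range MvPolynomial.C : Set (MvPolynomial V F))
      C.depth (2 * C.size + 1) C.polynomial := by
  classical
  let _ := C.fintypeNode
  -- The size counts edges only, so isolated nodes must go: the output and the tails of edges number
  -- at most `C.size + 1`.
  let K : Finset C.Node := insert C.out
    (Finset.univ.biUnion fun v => (C.gate v).inputs.toFinset)
  have hK : ∀ v, ∀ u ∈ (C.gate v).inputs, u ∈ K := fun v u hu =>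
    Finset.mem_insert_of_mem (Finset.mem_biUnion.2 ⟨v, Finset.mem_univ _, Multiset.mem_toFinset.2 hu⟩)
  have hmap : ∀ (B : Type _) (v : C.Node) (f : C.Node → B),
      (((C.gate v).inputs.attach.map fun u => (⟨u.1, hK v u.1 u.2⟩ : K)).map fun u : K => f u) =
      (C.gate v).inputs.map f := by
    intro B v f
    rw [Multiset.map_map]
    exact Multiset.attach_map_val' _ f
  refine ⟨K, inferInstance, fun v => (C.gate v).inputs.attach.map fun u => ⟨u.1, hK v u.1 u.2⟩,
    fun v => C.value v, fun v => C.nodeDepth v, ⟨C.out, Finset.mem_insert_self _ _⟩, rfl,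
    fun v => Finset.le_sup (f := C.nodeDepth) (Finset.mem_univ v.1), ?_, ?_, ?_⟩
  · rintro v u hu
    obtain ⟨y, -, rfl⟩ := Multiset.mem_map.1 hu
    change C.nodeDepth y < C.nodeDepth v
    rw [C.nodeDepth_eq v]
    exact Nat.lt_of_succ_le (Multiset.le_sup (Multiset.mem_map_of_mem _ y.2))
  · rintro ⟨v, hv⟩
    rw [hmap _ v C.value]
    have h := C.value_eq v
    rcases hg : C.gate v with x | c | s | s <;> rw [hg] at h <;> simp only at h
    · left
      refine ⟨?_, Or.inl ⟨x, h.symm⟩⟩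
      rw [Multiset.map_eq_zero, ← Multiset.card_eq_zero, Multiset.card_attach, hg]; rfl
    · left
      refine ⟨?_, Or.inr ⟨c, h.symm⟩⟩
      rw [Multiset.map_eq_zero, ← Multiset.card_eq_zero, Multiset.card_attach, hg]; rfl
    · exact Or.inr (Or.inl h)
    · exact Or.inr (Or.inr h)
  · have h1 : Fintype.card K ≤ C.size + 1 := by
      rw [Fintype.card_coe]
      refine (Finset.card_insert_le _ _).trans (Nat.succ_le_succ ?_)
      refine Finset.card_biUnion_le.trans (Finset.sum_le_sum fun v _ => ?_)
      exact Multiset.toFinset_card_le _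
    have h2 : ∑ v : K, ((C.gate v).inputs.attach.map fun u => (⟨u.1, hK v u.1 u.2⟩ : K)).card ≤
        C.size := by
      simp only [Multiset.card_map, Multiset.card_attach]
      rw [Finset.sum_coe_sort K fun v => (C.gate v).inputs.card]
      exact Finset.sum_le_sum_of_subset (Finset.subset_univ _)
    exact (add_le_add h1 h2).trans (by omega)

theorem exists_of_hasCircuit [CommSemiring F] {δ N : ℕ} {f : MvPolynomial V F}
    (h : HasCircuit (Set.range MvPolynomial.X ∪ Set.range MvPolynomial.C) δ N f) :
    ∃ C : AlgCircuit F V, C.polynomial = f ∧ C.depth ≤ δ ∧ C.size ≤ N := by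
  classical
  obtain ⟨Node, i, inputs, val, dep, out, h1, h2, h3, h4, h5⟩ := h
  have hg : ∀ v, ∃ g : CircuitGate F V Node, g.inputs = inputs v ∧
      val v = match g with
      | .var x => MvPolynomial.X x
      | .const a => MvPolynomial.C a
      | .add s => (s.map val).sum
      | .mul s => (s.map val).prod := by
    intro v
    rcases h4 v with ⟨h, ⟨x, hx⟩ | ⟨c, hc⟩⟩ | h | h
    · exact ⟨.var x, h.symm, hx.symm⟩
    · exact ⟨.const c, h.symm, hc.symm⟩
    · exact ⟨.add (inputs v), rfl, h⟩
    · exact ⟨.mul (inputs v), rfl, h⟩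
  choose gate hin hval using hg
  have hlt : ∀ v, ∀ u ∈ (gate v).inputs, dep u < dep v := fun v u hu => h3 v u (hin v ▸ hu)
  let C : AlgCircuit F V := ⟨Node, i, gate,
    Subrelation.wf (fun {a b} hab => hlt b a hab) (InvImage.wf dep wellFounded_lt), out⟩
  have hv : ∀ v, C.value v = val v := by
    intro v
    induction v using C.acyclic.induction with
    | _ v ih =>
      have ih' : ∀ u ∈ (gate v).inputs, C.value u = val u := ih
      have h1 := C.value_eq v
      have h2 := hval v
      rcases hgv : gate v with x | c | s | s <;> rw [hgv] at ih' h2 <;>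
        rw [show C.gate v = _ from hgv] at h1
      · exact h1.trans h2.symm
      · exact h1.trans h2.symm
      · exact h1.trans ((congrArg _ (Multiset.map_congr rfl ih')).trans h2.symm)
      · exact h1.trans ((congrArg _ (Multiset.map_congr rfl ih')).trans h2.symm)
  have hd : ∀ v, C.nodeDepth v ≤ dep v := by
    intro v
    induction v using C.acyclic.induction with
    | _ v ih =>
      rw [C.nodeDepth_eq v]
      refine Multiset.sup_le.2 fun b hb => ?_
      obtain ⟨u, hu, rfl⟩ := Multiset.mem_map.1 hb
      exact (Nat.succ_le_succ (ih u hu)).trans (hlt v u hu)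
  refine ⟨C, (hv out).trans h1, Finset.sup_le fun v _ => (hd v).trans (h2 v), ?_⟩
  refine le_trans ?_ h5
  refine le_trans (le_of_eq (Finset.sum_congr rfl fun v _ => ?_)) (Nat.le_add_left _ _)
  exact congrArg _ (hin v)

end AlgCircuit

/-! ### Interpolation, degree filtrations and the calculus of easy elements -/

open Polynomial in
/-- Interpolation: the coefficients of a polynomial of degree at most `D` over an `F`-algebra are
fixed linear combinations of its values at the points `0, …, D`. -/
theorem exists_interpolation (F : Type*) [Field F] [CharZero F] (D : ℕ) :
    ∃ c : Fin (D + 1) → Fin (D + 1) → F, ∀ (A : Type*) [CommRing A] [Algebra F A] (f : A[X]),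
      f.natDegree ≤ D → ∀ b : Fin (D + 1),
        f.coeff b = ∑ i, algebraMap F A (c b i) * f.eval (algebraMap F A (i : ℕ)) := by
  let v : Fin (D + 1) → F := fun i => ((i : ℕ) : F)
  have hv : Function.Injective v := fun i j h => Fin.ext (Nat.cast_injective h)
  have hdet : IsUnit (Matrix.vandermonde v).det :=
    isUnit_iff_ne_zero.2 (Matrix.det_vandermonde_ne_zero_iff.2 hv)
  set W := (Matrix.vandermonde v)⁻¹ with hW
  refine ⟨fun b i => W b i, fun A _ _ f hf b => ?_⟩
  have h1 : ∀ x : A, f.eval x = ∑ j : Fin (D + 1), f.coeff j * x ^ (j : ℕ) := fun x => by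
    rw [Polynomial.eval_eq_sum_range' (Nat.lt_succ_of_le hf), Finset.sum_range]
  have h2 : ∀ j : Fin (D + 1), ∑ i, W b i * v i ^ (j : ℕ) = if b = j then 1 else 0 := by
    intro j
    have := congrFun (congrFun (Matrix.nonsing_inv_mul _ hdet) b) j
    rw [Matrix.mul_apply, Matrix.one_apply] at this
    exact this
  simp_rw [h1, Finset.mul_sum]
  rw [Finset.sum_comm]
  have h3 : ∀ j : Fin (D + 1), ∑ i, algebraMap F A (W b i) *
      (f.coeff j * algebraMap F A (i : ℕ) ^ (j : ℕ)) =
      f.coeff j * algebraMap F A (if b = j then 1 else 0) := by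
    intro j
    rw [← h2 j, map_sum, Finset.mul_sum]
    refine Finset.sum_congr rfl fun i _ => ?_
    rw [map_mul, map_pow]
    ring
  simp_rw [h3]
  rw [Finset.sum_eq_single b]
  · simp
  · intro j _ hj
    simp [Ne.symm hj]
  · simp

/-- A set of admissible leaves of circuits over an algebra, together with a degree filtration. -/
structure GradedLeaves (F A : Type*) [Field F] [CommRing A] [Algebra F A] where
  leaf : Set A
  deg : ℕ → Submodule F A
  const_mem_leaf : ∀ c, algebraMap F A c ∈ leaf
  leaf_deg : ∀ a ∈ leaf, a ∈ deg 1
  deg_mono : ∀ i j, i ≤ j → deg i ≤ deg j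
  one_mem_deg : 1 ∈ deg 0
  mul_mem_deg : ∀ i j a b, a ∈ deg i → b ∈ deg j → a * b ∈ deg (i + j)

namespace GradedLeaves

variable {F A : Type*} [Field F] [CommRing A] [Algebra F A]

theorem const_mem_deg (G : GradedLeaves F A) (c : F) : algebraMap F A c ∈ G.deg 0 := by
  rw [Algebra.algebraMap_eq_smul_one]
  exact Submodule.smul_mem _ _ G.one_mem_deg

theorem prod_mem_deg (G : GradedLeaves F A) {ι : Type*} (s : Finset ι) (f : ι → A) (E : ℕ)
    (h : ∀ i ∈ s, f i ∈ G.deg E) : ∏ i ∈ s, f i ∈ G.deg (s.card * E) := by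
  classical
  induction s using Finset.induction_on with
  | empty => simpa using G.one_mem_deg
  | insert i s hi ih =>
    rw [Finset.prod_insert hi, Finset.card_insert_of_notMem hi]
    have := G.mul_mem_deg _ _ _ _ (h i (Finset.mem_insert_self _ _))
      (ih fun j hj => h j (Finset.mem_insert_of_mem hj))
    rwa [show (s.card + 1) * E = E + s.card * E by ring]

theorem pow_mem_deg (G : GradedLeaves F A) {a : A} {E : ℕ} (h : a ∈ G.deg E) (n : ℕ) :
    a ^ n ∈ G.deg (n * E) := by
  simpa using G.prod_mem_deg (Finset.range n) (fun _ => a) E fun _ _ => h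

/-- The leaves `X_v` and constants, and the total degree. -/
noncomputable def mv (F V : Type*) [Field F] : GradedLeaves F (MvPolynomial V F) where
  leaf := Set.range MvPolynomial.X ∪ Set.range MvPolynomial.C
  deg := MvPolynomial.restrictTotalDegree V F
  const_mem_leaf c := Or.inr ⟨c, rfl⟩
  leaf_deg := by
    rintro _ (⟨v, rfl⟩ | ⟨c, rfl⟩)
    · exact (MvPolynomial.mem_restrictTotalDegree _ _ _).2 (MvPolynomial.totalDegree_X v).le
    · exact (MvPolynomial.mem_restrictTotalDegree _ _ _).2 (by simp)
  deg_mono i j h a ha := by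
    rw [MvPolynomial.mem_restrictTotalDegree] at *
    exact ha.trans h
  one_mem_deg := by simp [MvPolynomial.mem_restrictTotalDegree]
  mul_mem_deg i j a b ha hb := by
    rw [MvPolynomial.mem_restrictTotalDegree] at *
    exact (MvPolynomial.totalDegree_mul _ _).trans (add_le_add ha hb)

open Polynomial

/-- The extension to the polynomial ring. -/
noncomputable def poly (G : GradedLeaves F A) : GradedLeaves F A[X] where
  leaf := {X} ∪ C '' G.leaf
  -- One number bounds both the degree in the new variable and the filtration degree of every
  -- coefficient, so a single bound serves all interpolations after `poly` is iterated.
  deg E :=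
    { carrier := {f | f.natDegree ≤ E ∧ ∀ b, f.coeff b ∈ G.deg E}
      add_mem' := fun {f g} hf hg => ⟨(natDegree_add_le f g).trans (max_le hf.1 hg.1), fun b => by
        rw [coeff_add]; exact Submodule.add_mem _ (hf.2 b) (hg.2 b)⟩
      zero_mem' := by simp
      smul_mem' := fun c f hf => ⟨(natDegree_smul_le c f).trans hf.1, fun b => by
        rw [coeff_smul]; exact Submodule.smul_mem _ _ (hf.2 b)⟩ }
  const_mem_leaf c := Or.inr ⟨algebraMap F A c, G.const_mem_leaf c, rfl⟩
  leaf_deg := by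
    rintro _ (rfl | ⟨a, ha, rfl⟩)
    · refine ⟨natDegree_X_le, fun b => ?_⟩
      rw [coeff_X]
      split_ifs
      · exact G.deg_mono _ _ zero_le_one G.one_mem_deg
      · exact Submodule.zero_mem _
    · refine ⟨by simp, fun b => ?_⟩
      rw [coeff_C]
      split_ifs
      · exact G.leaf_deg a ha
      · exact Submodule.zero_mem _
  deg_mono i j h f hf := ⟨hf.1.trans h, fun b => G.deg_mono _ _ h (hf.2 b)⟩
  one_mem_deg := by
    refine ⟨by simp, fun b => ?_⟩
    rw [coeff_one]
    split_ifs
    · exact G.one_mem_deg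
    · exact Submodule.zero_mem _
  mul_mem_deg i j f g hf hg := by
    refine ⟨natDegree_mul_le.trans (add_le_add hf.1 hg.1), fun b => ?_⟩
    rw [coeff_mul]
    exact Submodule.sum_mem _ fun x _ => G.mul_mem_deg _ _ _ _ (hf.2 _) (hg.2 _)

theorem mem_poly_deg {G : GradedLeaves F A} {E : ℕ} {f : A[X]} :
    f ∈ G.poly.deg E ↔ f.natDegree ≤ E ∧ ∀ b, f.coeff b ∈ G.deg E := Iff.rfl

theorem C_mem_poly_deg {G : GradedLeaves F A} {E : ℕ} {a : A} (h : a ∈ G.deg E) :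
    C a ∈ G.poly.deg E := by
  refine mem_poly_deg.2 ⟨by simp, fun b => ?_⟩
  rw [coeff_C]
  split_ifs
  · exact h
  · exact Submodule.zero_mem _

/-- The image of a polynomial under a substitution of elements of bounded degree. -/
theorem algHom_mem_deg (G : GradedLeaves F A) {V : Type*} (φ : MvPolynomial V F →ₐ[F] A) {E n : ℕ}
    (h : ∀ v, φ (MvPolynomial.X v) ∈ G.deg E) (f : MvPolynomial V F) (hf : f.totalDegree ≤ n) :
    φ f ∈ G.deg (n * E) := by
  classical
  rw [f.as_sum, map_sum]
  refine Submodule.sum_mem _ fun m hm => ?_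
  rw [MvPolynomial.monomial_eq, map_mul, ← MvPolynomial.algebraMap_eq, AlgHom.commutes,
    ← Algebra.smul_def]
  refine Submodule.smul_mem _ _ ?_
  have hm' : m.degree ≤ n := (MvPolynomial.le_totalDegree hm).trans hf
  refine G.deg_mono _ _ (Nat.mul_le_mul_right E hm') ?_
  clear hm hm'
  induction m using Finsupp.induction with
  | zero => simpa using G.one_mem_deg
  | single_add i k m hi _ ih =>
    rw [Finsupp.prod_add_index' (by simp) (by intros; rw [pow_add]), map_mul,
      Finsupp.prod_single_index (by simp), map_pow, map_add, Finsupp.degree_single, add_mul]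
    exact G.mul_mem_deg _ _ _ _ (G.pow_mem_deg (h i) k) ih

/-- The element `a` is computed by a circuit of depth at most `δ` and size at most `B ^ e`, and
its degree is at most `B ^ e`. -/
def Easy (G : GradedLeaves F A) (B δ e : ℕ) (a : A) : Prop :=
  HasCircuit G.leaf δ (B ^ e) a ∧ a ∈ G.deg (B ^ e)

namespace Easy

variable {G : GradedLeaves F A} {B δ δ' e e' c : ℕ} {a b : A}

theorem mono (hB : 2 ≤ B) (h : G.Easy B δ e a) (hδ : δ ≤ δ') (he : e ≤ e') : G.Easy B δ' e' a :=
  have := Nat.pow_le_pow_right (show 0 < B by omega) he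
  ⟨h.1.mono hδ this, G.deg_mono _ _ this h.2⟩

theorem leaf (h : a ∈ G.leaf) : G.Easy B 0 0 a := ⟨.leaf h, G.leaf_deg a h⟩

theorem const (x : F) : G.Easy B 0 0 (algebraMap F A x) := leaf (G.const_mem_leaf x)

/-- Since `B ^ 2 ≥ 4`, additive and multiplicative constants are absorbed into powers of `B`. A sum
or product therefore costs two levels and shifts the exponent by `c + 4`. -/
theorem size_bound (hB : 2 ≤ B) {m : ℕ} (hm : m ≤ B ^ c) :
    (2 * m + 1) * (B ^ e + 2) ≤ B ^ (c + e + 4) := by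
  have h1 : 1 ≤ B ^ c := Nat.one_le_pow _ _ (by omega)
  have h2 : 1 ≤ B ^ e := Nat.one_le_pow _ _ (by omega)
  have h3 : 4 ≤ B ^ 2 := by nlinarith
  calc (2 * m + 1) * (B ^ e + 2) ≤ (B ^ 2 * B ^ c) * (B ^ 2 * B ^ e) :=
        Nat.mul_le_mul (by nlinarith) (by nlinarith)
    _ = B ^ (c + e + 4) := by ring

theorem sum (hB : 2 ≤ B) {ι : Type*} (s : Finset ι) (f : ι → A) (hs : s.card ≤ B ^ c)
    (hf : ∀ i ∈ s, G.Easy B δ e (f i)) : G.Easy B (δ + 2) (c + e + 4) (∑ i ∈ s, f i) := by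
  refine ⟨(HasCircuit.sum s f fun i hi => (hf i hi).1).mono le_rfl (size_bound hB hs), ?_⟩
  refine Submodule.sum_mem _ fun i hi => ?_
  exact G.deg_mono _ _ (Nat.pow_le_pow_right (by omega) (by omega)) (hf i hi).2

theorem prod (hB : 2 ≤ B) {ι : Type*} (s : Finset ι) (f : ι → A) (hs : s.card ≤ B ^ c)
    (hf : ∀ i ∈ s, G.Easy B δ e (f i)) : G.Easy B (δ + 2) (c + e + 4) (∏ i ∈ s, f i) := by
  refine ⟨(HasCircuit.prod s f fun i hi => (hf i hi).1).mono le_rfl (size_bound hB hs), ?_⟩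
  refine G.deg_mono _ _ ?_ (G.prod_mem_deg s f _ fun i hi => (hf i hi).2)
  refine (Nat.mul_le_mul_right _ hs).trans ?_
  rw [← pow_add]
  exact Nat.pow_le_pow_right (by omega) (by omega)

theorem pow (hB : 2 ≤ B) (n : ℕ) (hn : n ≤ B ^ c) (h : G.Easy B δ e a) :
    G.Easy B (δ + 2) (c + e + 4) (a ^ n) := by
  simpa using prod hB (Finset.range n) (fun _ => a) (by simpa using hn) fun _ _ => h

theorem mul (hB : 2 ≤ B) (ha : G.Easy B δ e a) (hb : G.Easy B δ e b) :
    G.Easy B (δ + 2) (e + 5) (a * b) := by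
  have := prod hB (c := 1) Finset.univ ![a, b] (by simpa using hB)
    (by intro i _; fin_cases i; exacts [ha, hb]) (G := G) (δ := δ) (e := e)
  rw [Fin.prod_univ_two] at this
  exact this.mono hB le_rfl (by omega)

theorem add (hB : 2 ≤ B) (ha : G.Easy B δ e a) (hb : G.Easy B δ e b) :
    G.Easy B (δ + 2) (e + 5) (a + b) := by
  have := sum hB (c := 1) Finset.univ ![a, b] (by simpa using hB)
    (by intro i _; fin_cases i; exacts [ha, hb]) (G := G) (δ := δ) (e := e)
  rw [Fin.sum_univ_two] at this
  exact this.mono hB le_rfl (by omega)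

theorem const_mul (hB : 2 ≤ B) (x : F) (ha : G.Easy B δ e a) :
    G.Easy B (δ + 2) (e + 5) (algebraMap F A x * a) :=
  mul hB ((const x).mono hB (Nat.zero_le _) (Nat.zero_le _)) ha

theorem neg (hB : 2 ≤ B) (ha : G.Easy B δ e a) : G.Easy B (δ + 2) (e + 5) (-a) := by
  simpa using const_mul hB (-1) ha

theorem sub (hB : 2 ≤ B) (ha : G.Easy B δ e a) (hb : G.Easy B δ e b) :
    G.Easy B (δ + 4) (e + 10) (a - b) := by
  rw [sub_eq_add_neg]
  exact add hB (ha.mono hB (by omega) (by omega)) (neg hB hb)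

theorem map_C (ha : G.Easy B δ e a) : G.poly.Easy B δ e (C a) :=
  ⟨ha.1.map Polynomial.C fun x hx => Or.inr ⟨x, hx, rfl⟩, C_mem_poly_deg ha.2⟩

theorem X_poly : G.poly.Easy B 0 0 (Polynomial.X : A[X]) := leaf (Or.inl rfl)

/-- The leaf `X` turns into a constant leaf, so the circuit does not grow; the value is an
`F`-linear combination of the coefficients, so the degree bound survives. -/
theorem eval_const {f : A[X]} (hf : G.poly.Easy B δ e f) (x : F) :
    G.Easy B δ e (f.eval (algebraMap F A x)) := by
  refine ⟨hf.1.map (evalRingHom (algebraMap F A x)) ?_, ?_⟩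
  · rintro _ (rfl | ⟨a, ha, rfl⟩)
    · simpa using G.const_mem_leaf x
    · simpa using ha
  · rw [eval_eq_sum_range]
    refine Submodule.sum_mem _ fun i _ => ?_
    rw [← map_pow, mul_comm, ← Algebra.smul_def]
    exact Submodule.smul_mem _ _ ((mem_poly_deg.1 hf.2).2 i)

/-- Extraction of a coefficient by interpolation. -/
theorem coeff [CharZero F] (hB : 2 ≤ B) {f : A[X]} (hf : G.poly.Easy B δ e f) (b : ℕ) :
    G.Easy B (δ + 4) (2 * e + 10) (f.coeff b) := by
  obtain ⟨c, hc⟩ := exists_interpolation F (B ^ e)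
  by_cases hb : b < B ^ e + 1
  · rw [show f.coeff b = f.coeff (⟨b, hb⟩ : Fin (B ^ e + 1)) from rfl,
      hc A f (mem_poly_deg.1 hf.2).1]
    refine (sum hB (c := e + 1) Finset.univ _ ?_ fun i _ =>
      const_mul hB _ (hf.eval_const _)).mono hB le_rfl (by omega)
    rw [Finset.card_univ, Fintype.card_fin, pow_succ]
    have : 1 ≤ B ^ e := Nat.one_le_pow _ _ (by omega)
    nlinarith
  · rw [coeff_eq_zero_of_natDegree_lt (lt_of_le_of_lt (mem_poly_deg.1 hf.2).1 (by omega))]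
    simpa using (const (G := G) (B := B) (0 : F)).mono hB (Nat.zero_le _) (Nat.zero_le _)

/-- A polynomial is easy if its coefficients are. -/
theorem of_coeff (hB : 2 ≤ B) {f : A[X]} (hn : f.natDegree < B ^ c)
    (hf : ∀ i, G.Easy B δ e (f.coeff i)) : G.poly.Easy B (δ + 6) (2 * c + e + 13) f := by
  rw [f.as_sum_range_C_mul_X_pow' hn]
  refine (sum hB (c := c) (δ := δ + 4) (e := c + e + 9) (Finset.range (B ^ c)) _ (by simp)
    fun i hi => ?_).mono hB le_rfl (by omega)
  refine mul hB (δ := δ + 2) (e := c + e + 4) ((hf i).map_C.mono hB (by omega) (by omega)) ?_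
  exact (pow hB (c := c) i (Finset.mem_range.1 hi).le X_poly).mono hB (by omega) (by omega)

theorem map_const (hB : 2 ≤ B) {f : F[X]} (hn : f.natDegree < B ^ c) :
    G.poly.Easy B 6 (2 * c + 13) (f.map (algebraMap F A)) :=
  of_coeff hB (e := 0) (δ := 0) (lt_of_le_of_lt natDegree_map_le hn) fun i => by
    rw [coeff_map]; exact const _

end Easy

end GradedLeaves

/-! ### The residue formula for roots -/

/-- If `f = (z - r) ^ m * q` over a ring with a nilpotent element `τ` dividing `r`, and `f` differs
from `u` by a multiple of `τ`, where `u * w = z ^ m`, then `m * r` is the residue of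
`z * f' / f`, and the geometric series for `1 / f` in powers of `f - u` gives an explicit formula. -/
theorem coeff_residue_sum {R : Type*} [CommRing R] {m K : ℕ} (hm : 0 < m) (hK : 0 < K) {τ r : R}
    (hτ : τ ^ K = 0) (hr : τ ∣ r) {f q : Polynomial R} (hf : f = (Polynomial.X - Polynomial.C r) ^ m * q)
    (hq : IsUnit (q.coeff 0)) {E w : PowerSeries R} (hE : PowerSeries.C τ ∣ E)
    (hw : ((f : PowerSeries R) - E) * w = PowerSeries.X ^ m) :
    PowerSeries.coeff (m * K - 1) (PowerSeries.X * (Polynomial.derivative f : PowerSeries R) *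
      ∑ j ∈ Finset.range K, (-E) ^ j * w ^ (j + 1) * PowerSeries.X ^ (m * (K - 1 - j))) = m * r := by
  open PowerSeries in
  set S : PowerSeries R := ∑ j ∈ Finset.range K, (-E) ^ j * w ^ (j + 1) * X ^ (m * (K - 1 - j))
    with hS
  set n := m * K with hn
  have hn0 : 0 < n := Nat.mul_pos hm hK
  have hKn : K ≤ n := Nat.le_mul_of_pos_left K hm
  have hEK : (-E) ^ K = 0 := by
    obtain ⟨e, rfl⟩ := hE
    rw [neg_pow, mul_pow, ← map_pow, hτ]; simp
  have hrn : r ^ n = 0 := by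
    obtain ⟨e, rfl⟩ := hr
    rw [mul_pow, pow_eq_zero_of_le hKn hτ, zero_mul]
  -- `S` stands for `X ^ n / f`: the factor `X ^ n` clears the negative powers of `X` in the
  -- geometric series, which telescopes and stops because `E ^ K = 0`.
  have hfS : (f : PowerSeries R) * S = X ^ n := by
    have : (f : PowerSeries R) * S = ∑ j ∈ Finset.range K,
        ((-E) ^ j * w ^ j * X ^ (m * (K - j)) -
          (-E) ^ (j + 1) * w ^ (j + 1) * X ^ (m * (K - (j + 1)))) := by
      rw [hS, Finset.mul_sum]
      refine Finset.sum_congr rfl fun j hj => ?_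
      have hj' := Finset.mem_range.1 hj
      rw [show K - (j + 1) = K - 1 - j by omega,
        show m * (K - j) = m + m * (K - 1 - j) by
          rw [show K - j = 1 + (K - 1 - j) by omega]; ring, pow_add X, ← hw]
      ring
    rw [this, Finset.sum_range_sub' (fun j => (-E) ^ j * w ^ j * X ^ (m * (K - j)))]
    simp [hEK, hn]
  -- `X - C r` divides `X ^ n - r ^ n = X ^ n`, so it is not a zero divisor.
  have cancel : ∀ a b : PowerSeries R, (X - C r) * a = (X - C r) * b → a = b := by
    intro a b hab
    have h1 : (X : PowerSeries R) ^ n * (a - b) = 0 := by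
      have h2 : (X : PowerSeries R) ^ n =
          (∑ i ∈ Finset.range n, X ^ i * (C r) ^ (n - 1 - i)) * (X - C r) := by
        rw [geom_sum₂_mul, ← map_pow, hrn, map_zero, sub_zero]
      rw [h2, mul_assoc, mul_sub, hab, sub_self, mul_zero]
    ext i
    have h3 := congrArg (coeff (i + n)) h1
    rw [PowerSeries.coeff_X_pow_mul, map_zero, map_sub, sub_eq_zero] at h3
    exact h3
  obtain ⟨m', rfl⟩ : ∃ m', m = m' + 1 := ⟨m - 1, by omega⟩
  have hfc : (f : PowerSeries R) = (X - C r) ^ (m' + 1) * (q : PowerSeries R) := by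
    rw [hf]; simp
  have hgeom : (X - C r) ^ m' * (q : PowerSeries R) * S =
      ∑ i ∈ Finset.range n, X ^ i * (C r) ^ (n - 1 - i) := by
    apply cancel
    rw [mul_comm _ (∑ i ∈ Finset.range n, _), geom_sum₂_mul, ← map_pow, hrn, map_zero, sub_zero,
      ← hfS, hfc]
    ring
  have hqu : IsUnit (q : PowerSeries R) := by
    rw [PowerSeries.isUnit_iff_constantCoeff]
    simpa using hq
  obtain ⟨p, hp⟩ := hqu.exists_left_inv
  have hder : ((Polynomial.derivative f : Polynomial R) : PowerSeries R) =
      ((m' + 1 : ℕ) : PowerSeries R) * ((X - C r) ^ m' * (q : PowerSeries R)) +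
      (X - C r) ^ (m' + 1) * (Polynomial.derivative q : PowerSeries R) := by
    rw [hf, Polynomial.derivative_mul, Polynomial.derivative_X_sub_C_pow]
    have hc : (((m' : Polynomial R) : PowerSeries R)) = (m' : PowerSeries R) :=
      map_natCast Polynomial.coeToPowerSeries.ringHom m'
    simp [mul_assoc, hc]
  -- The logarithmic derivative `m / (X - r) + q' / q`, multiplied by `X ^ (n + 1)`. The second
  -- summand is a multiple of `X ^ n` and does not reach the coefficient at `n - 1`.
  have hmain : X * ((Polynomial.derivative f : Polynomial R) : PowerSeries R) * S =
      C ((m' + 1 : ℕ) : R) * (X * ∑ i ∈ Finset.range n, X ^ i * (C r) ^ (n - 1 - i)) +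
      X ^ n * (X * p * (Polynomial.derivative q : PowerSeries R)) := by
    rw [← hgeom, ← hfS, hfc, hder, map_natCast]
    linear_combination (-(X - C r) ^ (m' + 1) * S * X * (Polynomial.derivative q : PowerSeries R)) * hp
  rw [hmain, map_add, PowerSeries.coeff_X_pow_mul', if_neg (by omega), add_zero,
    PowerSeries.coeff_C_mul]
  congr 1
  rcases Nat.lt_or_ge 1 n with h1 | h1
  · rw [show n - 1 = n - 2 + 1 by omega, PowerSeries.coeff_succ_X_mul, map_sum,
      Finset.sum_eq_single (n - 2)]
    · rw [← map_pow, PowerSeries.coeff_mul_C, PowerSeries.coeff_X_pow, if_pos rfl,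
        show n - 2 + 1 - (n - 2) = 1 by omega]
      simp
    · intro i _ hi
      rw [← map_pow, PowerSeries.coeff_mul_C, PowerSeries.coeff_X_pow, if_neg (Ne.symm hi), zero_mul]
    · intro h
      exact absurd (Finset.mem_range.2 (by omega)) h
  -- Here `r ^ n = 0` already says `r = 0`, and the extracted constant coefficient is zero because
  -- of the factor `X`.
  · have : n = 1 := by omega
    rw [this, pow_one] at hrn
    rw [this, hrn]
    simp

namespace GradedLeaves

open Polynomial

/-- The residue formula in `A[T][z]`, modulo `T ^ K`, with truncated inverse. -/
theorem dvd_coeff_residue_sub {F A : Type*} [Field F] [CommRing A] [Algebra F A]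
    {f q : A[X][X]} {r : A[X]} {f₀ v : F[X]} {m K : ℕ} (hm : 0 < m) (hK : 0 < K)
    (hv : v.coeff 0 ≠ 0) (hf₀ : f₀ = X ^ m * v)
    (h0 : ∀ b, (f.coeff b).coeff 0 = algebraMap F A (f₀.coeff b))
    (hr : X ∣ r) (hf : C (X ^ K) ∣ f - (X - C r) ^ m * q) :
    X ^ K ∣ (X * derivative f * ∑ j ∈ Finset.range K, (-(f - f₀.map (algebraMap F A[X]))) ^ j *
      ((PowerSeries.trunc (m * K) (v : PowerSeries F)⁻¹).map (algebraMap F A[X])) ^ (j + 1) *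
      X ^ (m * (K - 1 - j))).coeff (m * K - 1) - (m : A[X]) * r := by
  set M := m * K with hM
  have hM0 : 0 < M := Nat.mul_pos hm hK
  set w : PowerSeries F := (v : PowerSeries F)⁻¹ with hw
  have hvw : (v : PowerSeries F) * w = 1 := PowerSeries.mul_inv_cancel _ (by simpa using hv)
  let I : Ideal A[X] := Ideal.span {X ^ K}
  let π : A[X] →+* A[X] ⧸ I := Ideal.Quotient.mk I
  let α : F →+* A[X] ⧸ I := π.comp (algebraMap F A[X])
  rw [← Ideal.mem_span_singleton, ← Ideal.Quotient.eq]
  change π _ = π _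
  have hπK : π X ^ K = 0 := by
    rw [← map_pow]; exact Ideal.Quotient.eq_zero_iff_mem.2 (Ideal.mem_span_singleton_self _)
  obtain ⟨u, hu⟩ := hf
  have hfπ : f.map π = (X - C (π r)) ^ m * q.map π := by
    have := congrArg (Polynomial.map π) hu
    rw [Polynomial.map_mul, Polynomial.map_C, map_pow, hπK, C_0, zero_mul, Polynomial.map_sub,
      sub_eq_zero] at this
    simpa using this
  have hEdvd : C (X : A[X]) ∣ f - f₀.map (algebraMap F A[X]) := by
    rw [C_dvd_iff_dvd_coeff]
    intro i
    rw [X_dvd_iff, coeff_sub, coeff_sub, h0, coeff_map, Polynomial.algebraMap_apply, coeff_C_zero,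
      sub_self]
  -- At `T = 0` the factorization reads `z ^ m * v = z ^ m * q(0, z)`. So the constant coefficient
  -- of `q` is a unit plus a multiple of `T`, which is nilpotent modulo `T ^ K`.
  have hq0 : (q.coeff 0).coeff 0 = algebraMap F A (v.coeff 0) := by
    let ε : A[X] →+* A := evalRingHom 0
    have h1 := congrArg (Polynomial.map ε) hu
    obtain ⟨r', rfl⟩ := hr
    have hε : ε X = 0 := eval_X
    have h2 : f.map ε = X ^ m * v.map (algebraMap F A) := by
      have : f.map ε = f₀.map (algebraMap F A) := by
        ext b
        rw [coeff_map, coeff_map, ← h0, coeff_zero_eq_eval_zero]; rfl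
      rw [this, hf₀]; simp
    rw [Polynomial.map_mul, Polynomial.map_C, map_pow, hε, zero_pow hK.ne', C_0, zero_mul,
      Polynomial.map_sub, sub_eq_zero, h2] at h1
    simp only [Polynomial.map_mul, Polynomial.map_pow, Polynomial.map_sub, Polynomial.map_X,
      Polynomial.map_C, map_mul, hε, zero_mul, C_0, sub_zero] at h1
    have h3 := congrArg (fun p => p.coeff (0 + m)) h1
    simp only [coeff_X_pow_mul] at h3
    rw [coeff_map, coeff_map] at h3
    rw [coeff_zero_eq_eval_zero (q.coeff 0)]
    exact h3.symm
  have hqu : IsUnit ((q.map π).coeff 0) := by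
    rw [coeff_map, ← divX_mul_X_add (q.coeff 0), hq0, map_add, map_mul]
    have h1 : IsUnit (π (C (algebraMap F A (v.coeff 0)))) :=
      ((isUnit_iff_ne_zero.2 hv).map (algebraMap F A[X])).map π
    refine IsNilpotent.isUnit_add_right_of_commute ⟨K, ?_⟩ h1 (Commute.all _ _)
    rw [mul_pow, hπK, mul_zero]
  have hEπ : PowerSeries.C (π X) ∣
      (((f - f₀.map (algebraMap F A[X])).map π : (A[X] ⧸ I)[X]) : PowerSeries (A[X] ⧸ I)) := by
    obtain ⟨e, he⟩ := hEdvd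
    exact ⟨((e.map π : (A[X] ⧸ I)[X]) : PowerSeries (A[X] ⧸ I)), by rw [he]; simp⟩
  have hwπ : (((f.map π : (A[X] ⧸ I)[X]) : PowerSeries (A[X] ⧸ I)) -
      (((f - f₀.map (algebraMap F A[X])).map π : (A[X] ⧸ I)[X]) : PowerSeries (A[X] ⧸ I))) *
      w.map α = PowerSeries.X ^ m := by
    have h1 : (((f.map π : (A[X] ⧸ I)[X]) : PowerSeries (A[X] ⧸ I)) -
      (((f - f₀.map (algebraMap F A[X])).map π : (A[X] ⧸ I)[X]) : PowerSeries (A[X] ⧸ I))) =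
      (f₀ : PowerSeries F).map α := by
      rw [← Polynomial.coe_sub, ← Polynomial.map_sub, sub_sub_cancel, Polynomial.map_map,
        Polynomial.polynomial_map_coe]
    rw [h1, ← map_mul, hf₀, Polynomial.coe_mul, mul_assoc, hvw]
    simp
  have key := coeff_residue_sum hm hK hπK (map_dvd π hr) hfπ hqu hEπ hwπ
  rw [map_mul π, map_natCast, ← key, ← coeff_map, ← Polynomial.coeff_coe]
  -- Only the coefficient at `M - 1` is read off, so truncating `1 / v` at order `M` changes
  -- nothing.
  suffices h : (PowerSeries.X : PowerSeries (A[X] ⧸ I)) ^ M ∣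
      (((PowerSeries.trunc M w).map α : (A[X] ⧸ I)[X]) : PowerSeries (A[X] ⧸ I)) - w.map α by
    let J : Ideal (PowerSeries (A[X] ⧸ I)) := Ideal.span {PowerSeries.X ^ M}
    rw [← Ideal.mem_span_singleton, ← Ideal.Quotient.eq] at h
    have h2 : ∀ a b : PowerSeries (A[X] ⧸ I), Ideal.Quotient.mk J a = Ideal.Quotient.mk J b →
        PowerSeries.coeff (M - 1) a = PowerSeries.coeff (M - 1) b := by
      intro a b hab
      rw [Ideal.Quotient.eq, Ideal.mem_span_singleton, PowerSeries.X_pow_dvd_iff] at hab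
      have := hab (M - 1) (by omega)
      rwa [map_sub, sub_eq_zero] at this
    apply h2
    have h3 : ∀ p : F[X], (p.map (algebraMap F A[X])).map π = p.map α := fun p =>
      Polynomial.map_map _ _ _
    simp only [Polynomial.map_mul, Polynomial.map_sum, Polynomial.map_pow, Polynomial.map_neg,
      Polynomial.map_X, h3, ← derivative_map]
    simp only [← Polynomial.coeToPowerSeries.ringHom_apply, map_sum, map_mul, map_pow, map_neg]
    simp only [Polynomial.coeToPowerSeries.ringHom_apply, Polynomial.coe_X]
    rw [h]
  rw [PowerSeries.X_pow_dvd_iff]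
  intro i hi
  rw [map_sub, Polynomial.coeff_coe, coeff_map, PowerSeries.coeff_trunc, if_pos hi,
    PowerSeries.coeff_map, sub_self]

/-- A truncated power series root is easy to compute if the polynomial is. -/
theorem Easy.root {F A : Type*} [Field F] [CharZero F] [CommRing A] [Nontrivial A] [Algebra F A]
    {G : GradedLeaves F A} {B δ e c : ℕ} (hB : 2 ≤ B)
    {f q : A[X][X]} {r : A[X]} {f₀ v : F[X]} {m K : ℕ} (hm : 0 < m) (hKc : K ≤ B ^ c)
    (hv : v.coeff 0 ≠ 0) (hf₀ : f₀ = X ^ m * v)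
    (h0 : ∀ b, (f.coeff b).coeff 0 = algebraMap F A (f₀.coeff b))
    (hr : X ∣ r) (hrK : r.natDegree < K) (hf : Polynomial.C (X ^ K) ∣ f - (X - Polynomial.C r) ^ m * q)
    (hfe : G.poly.poly.Easy B δ e f) : G.poly.Easy B (δ + 38) (18 * c + 16 * e + 260) r := by
  have hK : 0 < K := by omega
  have hdvd := dvd_coeff_residue_sub hm hK hv hf₀ h0 hr hf
  have hdeg : f.natDegree ≤ B ^ e := (mem_poly_deg.1 hfe.2).1
  have hlt : B ^ e < B ^ (e + 1) := Nat.pow_lt_pow_right (by omega) (by omega)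
  -- The degree of `f` thus bounds the multiplicity `m`, and with it the truncation order `m * K`.
  have hdeg₀ : f₀.natDegree ≤ B ^ e := by
    refine le_trans (natDegree_le_iff_coeff_eq_zero.2 fun i hi => ?_) hdeg
    have := h0 i
    rw [coeff_eq_zero_of_natDegree_lt hi, coeff_zero, eq_comm,
      FaithfulSMul.algebraMap_eq_zero_iff] at this
    exact this
  have hv0 : v ≠ 0 := by rintro rfl; simp at hv
  have hmB : m ≤ B ^ e := by
    refine le_trans ?_ hdeg₀
    rw [hf₀, natDegree_mul (pow_ne_zero _ X_ne_zero) hv0]; simp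
  have hM : m * K ≤ B ^ (e + c) := by
    rw [pow_add]; exact Nat.mul_le_mul hmB hKc
  set W := PowerSeries.trunc (m * K) (v : PowerSeries F)⁻¹ with hW
  have hWdeg : W.natDegree < B ^ (e + c) := by
    obtain ⟨n, hn⟩ : ∃ n, m * K = n + 1 := ⟨m * K - 1, by have := Nat.mul_pos hm hK; omega⟩
    rw [hW, hn]
    exact lt_of_lt_of_le (PowerSeries.natDegree_trunc_lt _ n) (hn ▸ hM)
  have eE : G.poly.poly.Easy B (δ + 10) (2 * e + 25) (f - f₀.map (algebraMap F A[X])) :=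
    (Easy.sub hB (δ := δ + 6) (e := 2 * e + 15) (hfe.mono hB (by omega) (by omega))
      ((Easy.map_const hB (c := e + 1) (by omega)).mono hB (by omega) (by omega))).mono hB
      (by omega) (by omega)
  have eD : G.poly.poly.Easy B (δ + 12) (4 * e + 30) (derivative f) := by
    refine (Easy.of_coeff hB (c := e + 1) (δ := δ + 6) (e := 2 * e + 15)
      (lt_of_le_of_lt (natDegree_derivative_le f) (by omega)) fun i => ?_).mono hB (by omega)
      (by omega)
    rw [coeff_derivative, mul_comm (f.coeff _)]
    have := Easy.const_mul hB ((i : F) + 1) (hfe.coeff hB (i + 1))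
    simpa using this
  have eS : G.poly.poly.Easy B (δ + 20) (4 * c + 2 * e + 48) (∑ j ∈ Finset.range K,
      (-(f - f₀.map (algebraMap F A[X]))) ^ j * (W.map (algebraMap F A[X])) ^ (j + 1) *
      X ^ (m * (K - 1 - j))) := by
    refine (Easy.sum hB (c := c) (δ := δ + 18) (e := 3 * c + 2 * e + 44) _ _ (by simpa using hKc)
      fun j hj => ?_).mono hB (by omega) (by omega)
    have hj' := Finset.mem_range.1 hj
    refine Easy.mul hB (δ := δ + 16) (e := 3 * c + 2 * e + 39)
      (Easy.mul hB (δ := δ + 14) (e := 3 * c + 2 * e + 34) ?_ ?_) ?_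
    · exact ((eE.neg hB).pow hB (c := c) j (by omega)).mono hB (by omega) (by omega)
    · exact ((Easy.map_const hB hWdeg).pow hB (c := c) (j + 1) (by omega)).mono hB (by omega)
        (by omega)
    · refine (Easy.X_poly.pow hB (c := e + c) _ ?_).mono hB (by omega) (by omega)
      exact (Nat.mul_le_mul_left m (by omega)).trans hM
  have eP := ((Easy.mul hB (δ := δ + 20) (e := 4 * c + 4 * e + 48)
    ((Easy.mul hB (Easy.X_poly.mono hB (Nat.zero_le _) (Nat.zero_le _)) eD).mono hB (by omega)
      (by omega)) (eS.mono hB (by omega) (by omega)))).coeff hB (m * K - 1)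
  refine (Easy.of_coeff hB (c := c) (δ := δ + 32) (e := 16 * c + 16 * e + 247) (by omega)
    fun a => ?_).mono hB (by omega) (by omega)
  rcases Nat.lt_or_ge a K with ha | ha
  -- As `r` has degree less than `K`, the congruence modulo `T ^ K` determines all its coefficients,
  -- after division by `m`.
  · have h1 := X_pow_dvd_iff.1 hdvd a ha
    rw [coeff_sub, sub_eq_zero, ← C_eq_natCast, coeff_C_mul] at h1
    have h2 : r.coeff a = algebraMap F A ((m : F)⁻¹) * ((m : A) * r.coeff a) := by
      rw [← mul_assoc, ← map_natCast (algebraMap F A) m, ← map_mul,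
        inv_mul_cancel₀ (Nat.cast_ne_zero.2 hm.ne'), map_one, one_mul]
    rw [h2, ← h1]
    exact (Easy.const_mul hB _ (eP.coeff hB a)).mono hB (by omega) (by omega)
  · rw [coeff_eq_zero_of_natDegree_lt (by omega)]
    simpa using (Easy.const (G := G) (B := B) (0 : F)).mono hB (Nat.zero_le _) (Nat.zero_le _)

end GradedLeaves

/-! ### Divisibility by a monic polynomial as the vanishing of easy coefficients -/

section SeedCircuit

open Polynomial


/-- Divisibility by a monic polynomial in terms of power series division of the reversed
polynomials. -/
theorem Polynomial.Monic.dvd_iff_coeff_reflect {R : Type*} [CommRing R] [Nontrivial R]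
    {P Q : R[X]} {l D : ℕ} (hQ : Q.Monic) (hl : Q.natDegree = l) (hP : P.natDegree ≤ D)
    (hlD : l ≤ D) :
    Q ∣ P ↔ ∀ i, D - l < i → i ≤ D →
      (reflect D P * ∑ j ∈ Finset.range (D + 1), (1 - reflect l Q) ^ j).coeff i = 0 := by
  set g := ∑ j ∈ Finset.range (D + 1), (1 - reflect l Q) ^ j with hg
  have hX : X ∣ 1 - reflect l Q := by
    rw [X_dvd_iff, coeff_sub, coeff_reflect, revAt_le (Nat.zero_le _), Nat.sub_zero, ← hl,
      hQ.coeff_natDegree]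
    simp
  obtain ⟨y, hy⟩ := pow_dvd_pow_of_dvd hX (D + 1)
  -- The reversal of the monic `Q` has constant term 1, so the geometric sum `g` inverts it modulo
  -- `X ^ (D + 1)`.
  have hQg : reflect l Q * g = 1 - X ^ (D + 1) * y := by
    have := mul_neg_geom_sum (1 - reflect l Q) (D + 1)
    rw [sub_sub_cancel, hy] at this
    exact this
  set A := P /ₘ Q with hA
  set b := P %ₘ Q with hb
  have hdecomp : P = Q * A + b := by rw [add_comm, modByMonic_add_div P Q]
  have hAdeg : A.natDegree ≤ D - l := by
    rw [hA, natDegree_divByMonic P hQ, hl]; omega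
  have hbdeg : ∀ j, l ≤ j → b.coeff j = 0 := fun j hj => by
    apply coeff_eq_zero_of_degree_lt
    refine lt_of_lt_of_le (degree_modByMonic_lt P hQ) ?_
    rw [degree_eq_natDegree hQ.ne_zero, hl]
    exact_mod_cast hj
  -- Multiplied by `g`, the quotient contributes only `reflect (D - l) A` in degrees up to `D`. Its
  -- degree is at most `D - l`, so the coefficients above `D - l` see the remainder alone.
  have hrefl : reflect D P = reflect l Q * reflect (D - l) A + reflect D b := by
    rw [← reflect_mul Q A hl.le hAdeg, Nat.add_sub_cancel' hlD, ← reflect_add, ← hdecomp]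
  have hcoeff : ∀ i, D - l < i → i ≤ D →
      (reflect D P * g).coeff i = (reflect D b * g).coeff i := by
    intro i hi hiD
    have : reflect D P * g = reflect (D - l) A + reflect D b * g -
        X ^ (D + 1) * (y * reflect (D - l) A) := by
      rw [hrefl]
      linear_combination reflect (D - l) A * hQg
    rw [this, coeff_sub, coeff_add, coeff_X_pow_mul', if_neg (by omega), sub_zero, coeff_reflect,
      revAt_eq_self_of_lt hi, coeff_eq_zero_of_natDegree_lt (lt_of_le_of_lt hAdeg hi), zero_add]
  constructor
  · intro h i hi hiD
    rw [hcoeff i hi hiD, hb, (modByMonic_eq_zero_iff_dvd hQ).2 h]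
    simp
  · intro h
    rw [← modByMonic_eq_zero_iff_dvd hQ, ← hb]
    -- The remainder has degree less than `l`, so its reversal starts above `D - l`. With the tested
    -- coefficients zero, `reflect D b * g` vanishes modulo `X ^ (D + 1)`, and cancelling the unit
    -- `g` gives `b = 0`.
    have h1 : X ^ (D - l + 1) ∣ reflect D b := by
      rw [X_pow_dvd_iff]
      intro i hi
      rw [coeff_reflect, revAt_le (by omega)]
      exact hbdeg _ (by omega)
    have h2 : X ^ (D + 1) ∣ reflect D b * g := by
      rw [X_pow_dvd_iff]
      intro i hi
      rcases Nat.lt_or_ge (D - l) i with hi' | hi'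
      · rw [← hcoeff i hi' (by omega)]
        exact h i hi' (by omega)
      · exact X_pow_dvd_iff.1 (h1.mul_right g) i (by omega)
    have h3 : X ^ (D + 1) ∣ reflect D b := by
      have h4 : reflect D b = reflect D b * g * reflect l Q + X ^ (D + 1) * (y * reflect D b) := by
        linear_combination -reflect D b * hQg
      rw [h4]
      exact dvd_add (h2.mul_right _) (dvd_mul_right _ _)
    ext j
    rw [coeff_zero]
    rcases Nat.lt_or_ge D j with hj | hj
    · exact hbdeg j (by omega)
    · have := X_pow_dvd_iff.1 h3 (D - j) (by omega)
      rwa [coeff_reflect, revAt_le (Nat.sub_le _ _), Nat.sub_sub_self hj] at this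

namespace GradedLeaves

/-- Interpolating the coefficients and expanding in powers of `X + x` controls the circuit and the
degree filtration together. -/
theorem Easy.comp_X_add_const {F A : Type*} [Field F] [CharZero F] [CommRing A] [Algebra F A]
    {G : GradedLeaves F A} {B δ e : ℕ} (hB : 2 ≤ B) {f : A[X]} (hf : G.poly.Easy B δ e f) (x : F) :
    G.poly.Easy B (δ + 8) (3 * e + 20) (f.comp (X + Polynomial.C (algebraMap F A x))) := by
  have hdeg : f.natDegree ≤ B ^ e := (mem_poly_deg.1 hf.2).1
  rw [comp, eval₂_eq_sum_range]
  refine (Easy.sum hB (c := e + 1) (δ := δ + 6) (e := 2 * e + 15) _ _ ?_ fun b hb => ?_).mono hB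
    (by omega) (by omega)
  · rw [Finset.card_range, pow_succ]
    have : 1 ≤ B ^ e := Nat.one_le_pow _ _ (by omega)
    nlinarith
  · refine Easy.mul hB (δ := δ + 4) (e := 2 * e + 10) (hf.coeff hB b).map_C ?_
    have hb' := Finset.mem_range.1 hb
    exact ((Easy.X_poly.add hB (Easy.const (G := G.poly) x)).pow hB (c := e) b (by omega)).mono hB
      (by omega) (by omega)

theorem Easy.reflect {F A : Type*} [Field F] [CommRing A] [Algebra F A]
    {G : GradedLeaves F A} {B δ e c N : ℕ} (hB : 2 ≤ B) {f : A[X]} (hN : N < B ^ c)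
    (hfN : f.natDegree ≤ N) (hf : ∀ i, G.Easy B δ e (f.coeff i)) :
    G.poly.Easy B (δ + 6) (2 * c + e + 13) (Polynomial.reflect N f) :=
  Easy.of_coeff hB (lt_of_le_of_lt ((natDegree_reflect_le).trans (max_le le_rfl hfN)) hN)
    fun i => by rw [coeff_reflect]; exact hf _

/-- A truncated, nondegenerate, approximate root is easy. -/
theorem Easy.approxRoot {F A : Type*} [Field F] [CharZero F] [CommRing A] [Nontrivial A]
    [Algebra F A] {G : GradedLeaves F A} {B δ e c k : ℕ} (hB : 2 ≤ B) {P : A[X][X]} {R : A[X]}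
    {p₀ : F[X]} {α : F} (hP : G.poly.poly.Easy B δ e P) (hkc : k ≤ B ^ c)
    (h0 : P.map (evalRingHom 0) = p₀.map (algebraMap F A)) (hα : R.eval 0 = algebraMap F A α)
    (hroot : X ^ k ∣ P.eval R) (htr : R.natDegree < k) (hnd : (derivative p₀).eval α ≠ 0) :
    G.poly.Easy B (δ + 48) (18 * c + 48 * e + 585) R := by
  set r := R - algebraMap F A[X] α with hr
  set f := P.comp (X + C (algebraMap F A[X] α)) with hf
  set f₀ := p₀.comp (X + C α) with hf₀
  have hfr : f.eval r = P.eval R := by simp [hf, hr]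
  have hε : f.map (evalRingHom 0) = f₀.map (algebraMap F A) := by
    rw [hf, Polynomial.map_comp, h0, hf₀, Polynomial.map_comp]
    simp
  have hp0 : p₀.eval α = 0 := by
    obtain ⟨u, hu⟩ := hroot
    have h1 := congrArg (eval 0) hu
    rw [← coe_evalRingHom, ← Polynomial.eval_map_apply, h0, coe_evalRingHom, hα,
      eval_map_algebraMap, aeval_algebraMap_apply] at h1
    rw [eval_mul, eval_pow, eval_X, zero_pow (by omega), zero_mul,
      FaithfulSMul.algebraMap_eq_zero_iff] at h1
    simpa using h1
  have hf₀0 : f₀.coeff 0 = 0 := by rw [coeff_zero_eq_eval_zero, hf₀]; simpa using hp0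
  -- Non-degeneracy makes `0` a simple root of `f₀`, which allows `m = 1` below.
  have hf₀1 : f₀.divX.coeff 0 ≠ 0 := by
    have : f₀.divX.coeff 0 = (derivative f₀).coeff 0 := by simp [coeff_divX, coeff_derivative]
    rw [this, coeff_zero_eq_eval_zero, hf₀, derivative_comp]
    simpa using hnd
  have hrX : X ∣ r := by
    rw [X_dvd_iff, hr, coeff_sub, coeff_zero_eq_eval_zero, hα, Polynomial.algebraMap_apply,
      coeff_C_zero, sub_self]
  have hrk : r.natDegree < k := by
    rw [hr, Polynomial.algebraMap_apply, natDegree_sub_C]; exact htr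
  have hf₀X : f₀ = X ^ 1 * f₀.divX := by
    conv_lhs => rw [← divX_mul_X_add f₀, hf₀0, C_0, add_zero]
    ring
  have hre := Easy.root hB (m := 1) (K := k) (f := f) (q := f /ₘ (X - C r)) (v := f₀.divX)
    one_pos hkc hf₀1 hf₀X (fun b => by
      have := congrArg (fun p => p.coeff b) hε
      simp only [coeff_map] at this
      rw [coeff_zero_eq_eval_zero]; exact this) hrX hrk (by
      -- The remainder on division by `z - r` is `f(r) = P(R)`, a multiple of `T ^ k`.
      have h1 : f - (X - C r) ^ 1 * (f /ₘ (X - C r)) = C (P.eval R) := by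
        rw [← hfr, ← modByMonic_X_sub_C_eq_C_eval, pow_one]
        nth_rw 1 [← modByMonic_add_div f (X - C r)]
        ring
      rw [h1]
      exact map_dvd C hroot)
    (hP.comp_X_add_const hB α)
  have : R = r + algebraMap F A[X] α := by rw [hr]; ring
  rw [this]
  exact (hre.add hB ((Easy.const α).mono hB (Nat.zero_le _) (Nat.zero_le _))).mono hB
    (by omega) (by omega)

/-- If a polynomial is not divisible by the truncated product of its approximate roots, then there
is an easy nonzero element that is killed by all the ring homomorphisms that make it divisible. -/
theorem exists_easy_of_not_dvd {F A : Type*} [Field F] [CharZero F] [CommRing A] [Nontrivial A]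
    [Algebra F A] {G : GradedLeaves F A} {B δ e c k l : ℕ} (hB : 2 ≤ B) {P Q : A[X][X]}
    {R : Fin l → A[X]} {p₀ : F[X]} {α : Fin l → F} (hP : G.poly.poly.Easy B δ e P)
    (hk : 0 < k) (hkc : k ≤ B ^ c) (hlc : l ≤ B ^ c)
    (h0 : P.map (evalRingHom 0) = p₀.map (algebraMap F A))
    (hα : ∀ i, (R i).eval 0 = algebraMap F A (α i))
    (hroot : ∀ i, X ^ k ∣ P.eval (R i)) (htr : ∀ i, (R i).natDegree < k)
    (hnd : ∀ i, (derivative p₀).eval (α i) ≠ 0)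
    (hQ : ∀ b a, (Q.coeff b).coeff a =
      if a < k then ((∏ i, (X - C (R i))).coeff b).coeff a else 0)
    (hQP : ¬ Q ∣ P) :
    ∃ f : A, f ≠ 0 ∧ G.Easy B (δ + 92) (328 * c + 776 * e + 9990) f ∧
      ∀ (A' : Type*) [CommRing A'] [Nontrivial A'] (φ : A →+* A'),
        Q.map (mapRingHom φ) ∣ P.map (mapRingHom φ) → φ f = 0 := by
  have hprod : (∏ i, (X - C (R i))).Monic := monic_prod_X_sub_C _ _
  have hprodd : (∏ i, (X - C (R i))).natDegree = l := by simp
  have hQl : Q.coeff l = 1 := by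
    ext a
    have h1 := hprod.coeff_natDegree
    rw [hprodd] at h1
    rw [hQ, h1, coeff_one]
    split_ifs <;> first | rfl | omega
  have hQd : Q.natDegree ≤ l := natDegree_le_iff_coeff_eq_zero.2 fun b hb => by
    ext a
    rw [hQ, coeff_eq_zero_of_natDegree_lt (p := ∏ i, (X - C (R i))) (by omega)]
    simp
  have hQm : Q.Monic := monic_of_natDegree_le_of_coeff_eq_one l hQd hQl
  have hQd' : Q.natDegree = l := le_antisymm hQd (le_natDegree_of_ne_zero (by rw [hQl]; exact one_ne_zero))
  -- The filtration bounds `deg P` by `B ^ e`; adding `l` ensures `l ≤ D` without comparing the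
  -- degrees of `P` and `Q`.
  set D := B ^ e + l with hD
  have hPD : P.natDegree ≤ D := (mem_poly_deg.1 hP.2).1.trans (Nat.le_add_right _ _)
  have hDB : D + 1 ≤ B ^ (e + c + 2) := by
    have h1 : 1 ≤ B ^ e := Nat.one_le_pow _ _ (by omega)
    have h2 : 1 ≤ B ^ c := Nat.one_le_pow _ _ (by omega)
    have h3 : 4 ≤ B ^ 2 := by nlinarith
    calc D + 1 ≤ B ^ e + B ^ c + 1 := by omega
      _ ≤ (B ^ e * B ^ c) * 4 := by nlinarith
      _ ≤ (B ^ e * B ^ c) * B ^ 2 := Nat.mul_le_mul_left _ h3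
      _ = B ^ (e + c + 2) := by ring
  set g := ∑ j ∈ Finset.range (D + 1), (1 - Polynomial.reflect l Q) ^ j with hg
  have hnot := hQP
  rw [hQm.dvd_iff_coeff_reflect hQd' hPD (Nat.le_add_left _ _)] at hnot
  push Not at hnot
  obtain ⟨i, hi, hiD, hne⟩ := hnot
  obtain ⟨a, ha⟩ : ∃ a, ((Polynomial.reflect D P * g).coeff i).coeff a ≠ 0 := by
    by_contra hcon
    push Not at hcon
    exact hne (Polynomial.ext fun a => by rw [hcon a, coeff_zero])
  refine ⟨_, ha, ?_, ?_⟩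
  · have eR := fun i => (Easy.approxRoot hB hP hkc h0 (hα i) (hroot i) (htr i) (hnd i))
    have eprod : G.poly.poly.Easy B (δ + 54) (19 * c + 48 * e + 599) (∏ i, (X - C (R i))) :=
      (Easy.prod hB (c := c) (δ := δ + 52) (e := 18 * c + 48 * e + 595) _ _ (by simpa using hlc)
        fun i _ => Easy.sub hB (Easy.X_poly.mono hB (Nat.zero_le _) (Nat.zero_le _))
          (eR i).map_C).mono hB (by omega) (by omega)
    -- Truncation is performed on coefficients: interpolate in `z`, then in `T`, and keep the
    -- indices below `k`.
    have eQc : ∀ b, G.poly.Easy B (δ + 68) (78 * c + 192 * e + 2439) (Q.coeff b) := fun b => by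
      refine (Easy.of_coeff hB (c := c) (δ := δ + 62) (e := 76 * c + 192 * e + 2426) ?_
        fun a => ?_).mono hB (by omega) (by omega)
      · have : (Q.coeff b).natDegree ≤ k - 1 := natDegree_le_iff_coeff_eq_zero.2 fun a ha => by
          rw [hQ, if_neg (by omega)]
        omega
      · rw [hQ]
        split_ifs
        · exact ((eprod.coeff hB b).coeff hB a).mono hB (by omega) (by omega)
        · simpa using (Easy.const (G := G) (B := B) (0 : F)).mono hB (Nat.zero_le _) (Nat.zero_le _)
    have eQ := Easy.reflect hB (c := c + 1) (N := l)
      (lt_of_le_of_lt hlc (Nat.pow_lt_pow_right (by omega) (by omega))) hQd eQc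
    have eg : G.poly.poly.Easy B (δ + 82) (82 * c + 194 * e + 2485) g := by
      refine (Easy.sum hB (c := e + c + 2) (δ := δ + 80) (e := 81 * c + 193 * e + 2479) _ _
        (by simpa using hDB) fun j hj => ?_).mono hB (by omega) (by omega)
      have hj' := Finset.mem_range.1 hj
      refine (Easy.pow hB (c := e + c + 2) (δ := δ + 78) (e := 80 * c + 192 * e + 2464) j (by omega)
        ?_).mono hB (by omega) (by omega)
      refine (Easy.sub hB (δ := δ + 74) (e := 80 * c + 192 * e + 2454) ?_
        (eQ.mono hB (by omega) (by omega))).mono hB (by omega) (by omega)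
      simpa using (Easy.const (G := G.poly.poly) (B := B) (1 : F)).mono hB (Nat.zero_le _) (Nat.zero_le _)
    have eP := Easy.reflect hB (c := e + c + 2) (N := D) (by omega) hPD fun i => hP.coeff hB i
    exact (((Easy.mul hB (δ := δ + 82) (e := 82 * c + 194 * e + 2485)
      (eP.mono hB (by omega) (by omega)) eg).coeff hB i).coeff hB a).mono hB (by omega) (by omega)
  -- Reversal and the geometric sum commute with `φ`, and the image of `Q` is still monic of degree
  -- `l`, so the same coefficient is tested.
  · intro A' _ _ φ hdvd
    have hmd : (Q.map (mapRingHom φ)).natDegree = l := by rw [hQm.natDegree_map, hQd']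
    rw [(hQm.map _).dvd_iff_coeff_reflect hmd (natDegree_map_le.trans hPD)
      (Nat.le_add_left _ _)] at hdvd
    have h1 := hdvd i hi hiD
    rw [reflect_map, reflect_map] at h1
    have h2 : Polynomial.map (mapRingHom φ) (Polynomial.reflect D P * g) =
        (Polynomial.reflect D P).map (mapRingHom φ) * ∑ j ∈ Finset.range (D + 1),
          (1 - (Polynomial.reflect l Q).map (mapRingHom φ)) ^ j := by
      simp [hg, Polynomial.map_sum]
    rw [← h2, coeff_map] at h1
    have h3 := congrArg (fun p => p.coeff a) h1
    simpa using h3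

end GradedLeaves

/-! ### Substitutions in which few variables move -/

/-- Encoding a monomial by `d` letters, each a variable or blank, bounds the number of monomials by
`(|W| + 1) ^ d`, hence by `ρ ^ d` when `|W| < ρ`. -/
theorem Finsupp.exists_eq_sum_single {W : Type*} (d : ℕ) (m : W →₀ ℕ) (hm : m.degree ≤ d) :
    ∃ φ : Fin d → Option W, m = ∑ i, (φ i).elim 0 fun w => Finsupp.single w 1 := by
  classical
  induction d generalizing m with
  | zero =>
    refine ⟨fun _ => none, ?_⟩
    simpa [Finsupp.degree_eq_zero_iff] using hm
  | succ d ih =>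
    by_cases h0 : m = 0
    · exact ⟨fun _ => none, by simp [h0]⟩
    · obtain ⟨w, hw⟩ := Finsupp.ne_iff.1 h0
      have hle : Finsupp.single w 1 ≤ m :=
        Finsupp.single_le_iff.2 (Nat.one_le_iff_ne_zero.2 hw)
      obtain ⟨m', rfl⟩ := exists_add_of_le hle
      rw [map_add, Finsupp.degree_single] at hm
      obtain ⟨φ, hφ⟩ := ih m' (by omega)
      exact ⟨Fin.cons (Option.some w) φ, by rw [Fin.sum_univ_succ]; simp [← hφ]⟩

theorem MvPolynomial.card_support_le_pow {W F : Type*} [Fintype W] [CommSemiring F]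
    (g : MvPolynomial W F) {d ρ : ℕ} (hg : g.totalDegree ≤ d) (hW : Fintype.card W < ρ) :
    g.support.card ≤ ρ ^ d := by
  classical
  have : g.support ⊆ (Finset.univ : Finset (Fin d → Option W)).image
      fun φ => ∑ i, (φ i).elim 0 fun w => Finsupp.single w 1 := fun m hm => by
    obtain ⟨φ, hφ⟩ := Finsupp.exists_eq_sum_single d m
      ((MvPolynomial.le_totalDegree hm).trans hg)
    exact Finset.mem_image.2 ⟨φ, Finset.mem_univ _, hφ.symm⟩
  refine (Finset.card_le_card this).trans (Finset.card_image_le.trans ?_)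
  rw [Finset.card_univ, Fintype.card_fun, Fintype.card_fin, Fintype.card_option]
  exact Nat.pow_le_pow_left hW d

theorem MvPolynomial.totalDegree_aeval_le_of_le_one {V W F : Type*} [Field F]
    (θ : V → MvPolynomial W F) (hθ : ∀ v, (θ v).totalDegree ≤ 1) (g : MvPolynomial V F) {d : ℕ}
    (hg : g.totalDegree ≤ d) : (MvPolynomial.aeval θ g).totalDegree ≤ d := by
  have := (GradedLeaves.mv F W).algHom_mem_deg (MvPolynomial.aeval θ) (E := 1)
    (fun v => by
      rw [MvPolynomial.aeval_X]
      exact (MvPolynomial.mem_restrictTotalDegree _ _ _).2 (hθ v)) g hg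
  simpa using (MvPolynomial.mem_restrictTotalDegree _ _ _).1 this

namespace GradedLeaves

variable {F A : Type*} [Field F] [CommRing A] [Algebra F A] {G : GradedLeaves F A}

theorem Easy.mono_base {B B' δ e : ℕ} {a : A} (h : G.Easy B δ e a) (hB : B ≤ B') :
    G.Easy B' δ e a :=
  ⟨h.1.mono le_rfl (Nat.pow_le_pow_left hB e), G.deg_mono _ _ (Nat.pow_le_pow_left hB e) h.2⟩

theorem Easy.algHom {V : Type*} {B δ e δ' e' : ℕ} (hB : 2 ≤ B) {f : MvPolynomial V F}
    (hf : (mv F V).Easy B δ e f) (φ : MvPolynomial V F →ₐ[F] A)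
    (hφ : ∀ v, G.Easy B δ' e' (φ (MvPolynomial.X v))) :
    G.Easy B (δ + δ' + 1) (e + e' + 2) (φ f) := by
  have h1 : 1 ≤ B ^ e' := Nat.one_le_pow _ _ (by omega)
  refine ⟨(hf.1.subst (φ : MvPolynomial V F →+* A) (δ' := δ') (N' := B ^ e') ?_).mono le_rfl ?_, ?_⟩
  · rintro _ (⟨v, rfl⟩ | ⟨c, rfl⟩)
    · exact (hφ v).1
    · have : φ (MvPolynomial.C c) = algebraMap F A c := φ.commutes c
      exact (HasCircuit.leaf (show (φ : MvPolynomial V F →+* A) (MvPolynomial.C c) ∈ G.leaf by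
        rw [RingHom.coe_coe, this]; exact G.const_mem_leaf c)).mono (Nat.zero_le _) h1
  · have h3 : 4 ≤ B ^ 2 := by nlinarith
    calc B ^ e * (B ^ e' + 2) ≤ B ^ e * (B ^ e' * B ^ 2) := Nat.mul_le_mul_left _ (by nlinarith)
      _ = B ^ (e + e' + 2) := by ring
  · have := G.algHom_mem_deg φ (fun v => (hφ v).2) f
      ((MvPolynomial.mem_restrictTotalDegree _ _ _).1 hf.2)
    refine G.deg_mono _ _ ?_ this
    rw [← pow_add]
    exact Nat.pow_le_pow_right (by omega) (by omega)

/-- Substitution of constants for all but a few of the variables, and of easy elements for the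
others. -/
theorem Easy.aeval_of_const {V : Type*} {B δ e d ρ : ℕ} (hB : 2 ≤ B) (θ : V → A)
    (W : Finset V) (hW : W.card < ρ) (hc : ∀ v ∉ W, ∃ c, θ v = algebraMap F A c)
    (hθ : ∀ v ∈ W, G.Easy B δ e (θ v)) (g : MvPolynomial V F) (hg : g.totalDegree ≤ d)
    (hρd : ρ ^ d ≤ B) (hd : d ≤ B) (hρ : ρ ≤ B) :
    G.Easy B (δ + 8) (e + 20) (MvPolynomial.aeval θ g) := by
  classical
  have hc' : ∀ v, ∃ c, v ∉ W → θ v = algebraMap F A c := fun v => by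
    by_cases h : v ∈ W
    · exact ⟨0, fun h' => absurd h h'⟩
    · obtain ⟨c, hc⟩ := hc v h
      exact ⟨c, fun _ => hc⟩
  choose c hc'' using hc'
  let η : V → MvPolynomial W F := fun v =>
    if h : v ∈ W then MvPolynomial.X ⟨v, h⟩ else MvPolynomial.C (c v)
  -- Specializing the constants first leaves a polynomial in the fewer than `ρ` variables of `W`,
  -- which is then expanded into its at most `ρ ^ d` monomials.
  have hη : MvPolynomial.aeval θ g =
      MvPolynomial.aeval (fun w : W => θ w) (MvPolynomial.aeval η g) := by
    rw [MvPolynomial.comp_aeval_apply]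
    congr 2
    funext v
    by_cases h : v ∈ W
    · simp [η, h]
    · simp only [η, dif_neg h, MvPolynomial.aeval_C]
      exact hc'' v h
  have hdeg : (MvPolynomial.aeval η g).totalDegree ≤ d := by
    refine MvPolynomial.totalDegree_aeval_le_of_le_one η (fun v => ?_) g hg
    by_cases h : v ∈ W
    · simp only [η, dif_pos h]; exact (MvPolynomial.totalDegree_X _).le
    · simp [η, dif_neg h]
  have hcard := MvPolynomial.card_support_le_pow _ hdeg (ρ := ρ) (by rwa [Fintype.card_coe])
  rw [hη, MvPolynomial.aeval_def, MvPolynomial.eval₂_eq']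
  refine (Easy.sum hB (c := 1) (δ := δ + 6) (e := e + 15) _ _ (by rw [pow_one]; omega)
    fun m hm => ?_).mono hB (by omega) (by omega)
  refine (Easy.const_mul hB _ (Easy.prod hB (c := 1) (δ := δ + 2) (e := e + 5) _ _ ?_
    fun w _ => ?_)).mono hB (by omega) (by omega)
  · rw [Finset.card_univ, Fintype.card_coe, pow_one]; omega
  · refine (Easy.pow hB (c := 1) _ ?_ (hθ w w.2)).mono hB (by omega) (by omega)
    rw [pow_one]
    exact ((Finsupp.le_degree w m).trans (MvPolynomial.le_totalDegree hm)).trans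
      (hdeg.trans hd)

end GradedLeaves

/-! ### The hybrid argument -/

/-- The hybrid argument: exchange one coordinate at a time. -/
theorem exists_hybrid_aeval {F A : Type*} [Field F] [CommRing A] [Algebra F A] {n : ℕ}
    (f : MvPolynomial (Fin n) F) (a b : Fin n → A) (ha : MvPolynomial.aeval a f ≠ 0)
    (hb : MvPolynomial.aeval b f = 0) :
    ∃ i : Fin n, (MvPolynomial.aeval (fun j => if j < i then C (b j) else if j = i then X
      else C (a j)) f : A[X]) ≠ 0 ∧ (MvPolynomial.aeval (fun j => if j < i then C (b j)
      else if j = i then X else C (a j)) f : A[X]).eval (b i) = 0 := by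
  have hm : ∃ m < n, MvPolynomial.aeval (fun j : Fin n => if (j : ℕ) < m then b j else a j) f ≠ 0 ∧
      MvPolynomial.aeval (fun j : Fin n => if (j : ℕ) < m + 1 then b j else a j) f = 0 := by
    by_contra hcon
    push Not at hcon
    have : ∀ m ≤ n,
        MvPolynomial.aeval (fun j : Fin n => if (j : ℕ) < m then b j else a j) f ≠ 0 := by
      intro m
      induction m with
      | zero => intro _; simpa using ha
      | succ m ih => intro h; exact hcon m h (ih (by omega))
    refine this n le_rfl ?_
    convert hb using 3 with j
    simp
  obtain ⟨m, hmn, h1, h2⟩ := hm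
  -- The polynomial joins two neighbouring hybrids: its value at `a m` is the nonzero one, its value
  -- at `b m` the zero one.
  have key : ∀ x : A, (MvPolynomial.aeval (fun j : Fin n => if j < ⟨m, hmn⟩ then C (b j) else
      if j = ⟨m, hmn⟩ then X else C (a j)) f : A[X]).eval x =
      MvPolynomial.aeval (fun j : Fin n => if (j : ℕ) < m then b j else
        if (j : ℕ) = m then x else a j) f := by
    intro x
    have h := MvPolynomial.comp_aeval_apply (fun j : Fin n => if j < ⟨m, hmn⟩ then C (b j) else
      if j = ⟨m, hmn⟩ then X else C (a j)) ((Polynomial.aeval x).restrictScalars F : A[X] →ₐ[F] A) f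
    rw [AlgHom.restrictScalars_apply, Polynomial.coe_aeval_eq_eval] at h
    rw [h]
    congr 2
    funext j
    simp only [Fin.lt_def, Fin.ext_iff]
    split_ifs <;> simp
  refine ⟨⟨m, hmn⟩, fun h0 => h1 ?_, ?_⟩
  · have := key (a ⟨m, hmn⟩)
    rw [h0, eval_zero] at this
    rw [this]
    congr 2
    funext j
    by_cases hj : (j : ℕ) = m
    · have : j = ⟨m, hmn⟩ := Fin.ext hj
      subst this
      simp
    · simp [hj]
  · rw [key, ← h2]
    congr 2
    funext j
    by_cases hj : (j : ℕ) = m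
    · have : j = ⟨m, hmn⟩ := Fin.ext hj
      subst this
      simp
    · have : (j : ℕ) < m + 1 ↔ (j : ℕ) < m := by omega
      simp [hj, this]

theorem MvPolynomial.map_aeval_polynomial {F V R R' : Type*} [CommSemiring F] [CommRing R]
    [CommRing R'] [Algebra F R] [Algebra F R'] (h : V → R[X]) (φ : R →ₐ[F] R')
    (f : MvPolynomial V F) :
    (MvPolynomial.aeval h f).map (φ : R →+* R') =
      MvPolynomial.aeval (fun v => (h v).map (φ : R →+* R')) f := by
  induction f using MvPolynomial.induction_on with
  | C c => simp [Polynomial.algebraMap_apply]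
  | add p q hp hq => rw [map_add, Polynomial.map_add, hp, hq, map_add]
  | mul_X p v hp => rw [map_mul, Polynomial.map_mul, hp, map_mul, aeval_X, aeval_X]

namespace GradedLeaves

/-! ### Roots restricted by `ψ` to a curve that passes through the point `ev` at parameter `0` -/

section LineRestriction

variable {F A A' : Type*} [Field F] [CommRing A] [Algebra F A] [CommRing A'] [Algebra F A']
  {G : GradedLeaves F A} {ψ : A' →ₐ[F] A[X]} {ev : A' →ₐ[F] F} {p q : A'[X]} {y : A'} {m : ℕ}

/-- A polynomial with a root `y`, restricted to a curve through a point and shifted such that the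
value of `y` at the point becomes zero. -/
theorem exists_shift_eq (hψ : ∀ a, (ψ a).eval 0 = algebraMap F A (ev a))
    (hp : p = (X - C y) ^ m * q) (hq : ev (q.eval y) ≠ 0) :
    ∃ (f₀ v : F[X]) (q' : A[X][X]),
      f₀ = (p.map (ev : A' →+* F)).comp (X + C (ev y)) ∧ v.coeff 0 ≠ 0 ∧ f₀ = X ^ m * v ∧
      (∀ b, ((((p.map (ψ : A' →+* A[X])).comp
        (X + C (algebraMap F A[X] (ev y)))).coeff b).coeff 0) = algebraMap F A (f₀.coeff b)) ∧
      (p.map (ψ : A' →+* A[X])).comp (X + C (algebraMap F A[X] (ev y))) =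
        (X - C (ψ y - algebraMap F A[X] (ev y))) ^ m * q' := by
  refine ⟨_, (q.map (ev : A' →+* F)).comp (X + C (ev y)),
    (q.map (ψ : A' →+* A[X])).comp (X + C (algebraMap F A[X] (ev y))), rfl, ?_, ?_, ?_, ?_⟩
  · rw [coeff_zero_eq_eval_zero, eval_comp]
    simp only [eval_add, eval_X, eval_C, zero_add]
    rw [← RingHom.coe_coe (f := ev), Polynomial.eval_map_apply, RingHom.coe_coe]
    exact hq
  · rw [hp]
    simp
  · intro b
    have hε : ((p.map (ψ : A' →+* A[X])).comp (X + C (algebraMap F A[X] (ev y)))).map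
        (evalRingHom 0) = ((p.map (ev : A' →+* F)).comp (X + C (ev y))).map (algebraMap F A) := by
      rw [Polynomial.map_comp, Polynomial.map_comp]
      congr 1
      · ext1 k
        simp only [coeff_map, RingHom.coe_coe, coe_evalRingHom]
        exact hψ _
      · simp
    have := congrArg (fun p => p.coeff b) hε
    simp only [coeff_map] at this
    rw [coeff_zero_eq_eval_zero]; exact this
  · rw [hp]
    simp only [Polynomial.map_mul, Polynomial.map_pow, Polynomial.map_sub, Polynomial.map_X,
      Polynomial.map_C, mul_comp, pow_comp, sub_comp, X_comp, C_comp, RingHom.coe_coe, C_sub]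
    congr 2
    ring

theorem X_dvd_sub_algebraMap (hψ : ∀ a, (ψ a).eval 0 = algebraMap F A (ev a)) (a : A') :
    X ∣ ψ a - algebraMap F A[X] (ev a) := by
  rw [X_dvd_iff, coeff_sub, coeff_zero_eq_eval_zero, hψ, Polynomial.algebraMap_apply,
    coeff_C_zero, sub_self]

/-- After the shift the root is divisible by the parameter, so `Easy.root` applies. The
factorization is exact, hence the congruence holds for every `K`, and `K` need only exceed the
degree of `ψ y`. -/
theorem Easy.of_isRoot_map [CharZero F] [Nontrivial A] {B δ e c K : ℕ} (hB : 2 ≤ B)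
    (hψ : ∀ a, (ψ a).eval 0 = algebraMap F A (ev a)) (hm : 0 < m)
    (hp : p = (X - Polynomial.C y) ^ m * q) (hq : ev (q.eval y) ≠ 0) (hK : (ψ y).natDegree < K)
    (hKc : K ≤ B ^ c) (hpe : G.poly.poly.Easy B δ e (p.map (ψ : A' →+* A[X]))) :
    G.poly.Easy B (δ + 48) (18 * c + 48 * e + 585) (ψ y) := by
  obtain ⟨f₀, v, q', -, hv, hf₀, h0, hf⟩ := exists_shift_eq hψ hp hq
  have er := Easy.root hB hm hKc hv hf₀ h0 (X_dvd_sub_algebraMap hψ y)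
    (by rw [Polynomial.algebraMap_apply, natDegree_sub_C]; exact hK)
    (by rw [← hf, sub_self]; exact dvd_zero _) (hpe.comp_X_add_const hB (ev y))
  have := er.add hB ((Easy.const (ev y)).mono hB (Nat.zero_le _) (Nat.zero_le _))
  rw [sub_add_cancel] at this
  exact this.mono hB (by omega) (by omega)

/-- The shifted root `r` satisfies `r ^ m * v(r) = 0` with `v` over `F`. Since `r` vanishes at
parameter `0` and `v(0) ≠ 0`, the second factor is nonzero, so `r = 0`. -/
theorem eq_algebraMap_of_isRoot_map [IsDomain A] (hψ : ∀ a, (ψ a).eval 0 = algebraMap F A (ev a))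
    (hm : 0 < m) (hp : p = (X - C y) ^ m * q) (hq : ev (q.eval y) ≠ 0)
    (hconst : p.map (ψ : A' →+* A[X]) = (p.map (ev : A' →+* F)).map (algebraMap F A[X])) :
    ψ y = algebraMap F A[X] (ev y) := by
  obtain ⟨f₀, v, q', hf₀', hv, hf₀, h0, hf⟩ := exists_shift_eq hψ hp hq
  have hr := X_dvd_sub_algebraMap hψ y
  set r := ψ y - algebraMap F A[X] (ev y) with hrdef
  have hf' : (X - C r) ^ m * q' = f₀.map (algebraMap F A[X]) := by
    rw [← hf, hconst, hf₀', Polynomial.map_comp]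
    simp
  have hev : r ^ m * (v.map (algebraMap F A[X])).eval r = 0 := by
    have h1 := congrArg (eval r) hf'
    rw [hf₀] at h1
    simpa [hm.ne'] using h1.symm
  rw [← sub_eq_zero]
  rcases mul_eq_zero.1 hev with h1 | h1
  · exact eq_zero_of_pow_eq_zero h1
  · exfalso
    obtain ⟨u, hu⟩ := hr
    have h2 := congrArg (evalRingHom (0 : A)) h1
    rw [← Polynomial.eval_map_apply, Polynomial.map_map, hu] at h2
    have h3 : (evalRingHom (0 : A)) (X * u) = 0 := by simp
    rw [h3, map_zero, ← coeff_zero_eq_eval_zero, coeff_map] at h2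
    rw [RingHom.comp_apply, Polynomial.algebraMap_apply, coe_evalRingHom, eval_C,
      FaithfulSMul.algebraMap_eq_zero_iff] at h2
    exact hv h2

end LineRestriction

/-! ### From an easy polynomial vanishing at the generator to a circuit for the seed -/

/-- If an easy nonzero polynomial vanishes at the generator, then its seed polynomial is constant
or easy. -/
theorem Easy.exists_C_or_hasCircuit_of_aeval_kiGenerator_eq_zero {F : Type*} [Field F] [CharZero F]
    {n σ μ ρ B δ e : ℕ} (hB : 2 ≤ B) {f : MvPolynomial (Fin n) F} (hf0 : f ≠ 0)
    (hf : (mv F (Fin n)).Easy B δ e f) (g : MvPolynomial (Fin σ) F) (S : Fin n → Finset (Fin μ))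
    (hS : IsDesign n σ μ ρ S) (hfg : MvPolynomial.aeval (kiGenerator g S hS) f = 0) :
    (∃ c, g = MvPolynomial.C c) ∨ HasCircuit (mv F (Fin σ)).leaf (δ + 65)
      ((B * ρ ^ g.totalDegree) ^ (48 * e + 2619)) g := by
  classical
  -- The hybrids live in `F[w, x]`: `inl` indexes the seed variables `w`, `inr` the independent
  -- variables `x`.
  let b : Fin n → (MvPolynomial (Fin μ ⊕ Fin n) F) := fun i => MvPolynomial.rename Sum.inl (kiGenerator g S hS i)
  let a : Fin n → (MvPolynomial (Fin μ ⊕ Fin n) F) := fun i => MvPolynomial.X (Sum.inr i)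
  obtain ⟨i, hp0, hpr⟩ := exists_hybrid_aeval f a b (by
      have : MvPolynomial.aeval a f = MvPolynomial.rename Sum.inr f := by
        rw [MvPolynomial.rename_eq_aeval]; rfl
      rw [this]
      exact fun h => hf0 (MvPolynomial.rename_injective _ Sum.inr_injective
        (by rw [h, map_zero]))) (by
      have := MvPolynomial.comp_aeval_apply (kiGenerator g S hS)
        (MvPolynomial.rename Sum.inl : MvPolynomial (Fin μ) F →ₐ[F] (MvPolynomial (Fin μ ⊕ Fin n) F)) f
      rw [hfg, map_zero] at this
      exact this.symm)
  set h : Fin n → (MvPolynomial (Fin μ ⊕ Fin n) F)[X] := fun j => if j < i then C (b j) else if j = i then X else C (a j) with hh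
  set p : (MvPolynomial (Fin μ ⊕ Fin n) F)[X] := MvPolynomial.aeval h f with hp
  obtain ⟨q, hq, hnd⟩ := Polynomial.exists_eq_pow_rootMultiplicity_mul_and_not_dvd p hp0 (b i)
  set m := p.rootMultiplicity (b i) with hm
  have hm0 : 0 < m := (Polynomial.rootMultiplicity_pos hp0).2 hpr
  have hqb : q.eval (b i) ≠ 0 := fun h => hnd (dvd_iff_isRoot.2 h)
  obtain ⟨pt, hpt⟩ : ∃ pt, MvPolynomial.eval pt (q.eval (b i)) ≠ 0 := by
    by_contra hcon
    push Not at hcon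
    exact hqb (MvPolynomial.funext fun x => by rw [hcon x, map_zero])
  let emb : ∀ j, Fin σ → Fin μ := fun j => (S j).orderEmbOfFin (hS.card_eq j)
  let idx : ∀ u, u ∈ S i → Fin σ := fun u hu => ((S i).orderIsoOfFin (hS.card_eq i)).symm ⟨u, hu⟩
  have hidx : ∀ v (hv : emb i v ∈ S i), idx (emb i v) hv = v := fun v hv => by
    simp only [idx]
    rw [OrderIso.symm_apply_eq]
    exact Subtype.ext (Finset.coe_orderIsoOfFin_apply _ _ _).symm
  -- The line is at the chosen point for parameter `0` and at the variables of `g` for parameter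
  -- `1`, where `ψ (b i)` becomes `g`.
  let line : Fin σ → F → (MvPolynomial (Fin σ) F)[X] := fun v x =>
    algebraMap F (MvPolynomial (Fin σ) F)[X] x + X * (C (MvPolynomial.X v) - algebraMap F (MvPolynomial (Fin σ) F)[X] x)
  let ξ : Fin μ ⊕ Fin n → (MvPolynomial (Fin σ) F)[X] := Sum.elim
    (fun u => if hu : u ∈ S i then line (idx u hu) (pt (Sum.inl u))
      else algebraMap F (MvPolynomial (Fin σ) F)[X] (pt (Sum.inl u)))
    (fun j => algebraMap F (MvPolynomial (Fin σ) F)[X] (pt (Sum.inr j)))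
  let ψ : (MvPolynomial (Fin μ ⊕ Fin n) F) →ₐ[F] (MvPolynomial (Fin σ) F)[X] := MvPolynomial.aeval ξ
  let ev : (MvPolynomial (Fin μ ⊕ Fin n) F) →ₐ[F] F := MvPolynomial.aeval pt
  have hevq : ev (q.eval (b i)) ≠ 0 := by
    rwa [show ev (q.eval (b i)) = MvPolynomial.eval pt (q.eval (b i)) from
      MvPolynomial.eval₂_id ..]
  have hψ0 : ∀ y, (ψ y).eval 0 = algebraMap F (MvPolynomial (Fin σ) F) (ev y) := by
    intro y
    have h1 : (((Polynomial.aeval (0 : (MvPolynomial (Fin σ) F))).restrictScalars F : (MvPolynomial (Fin σ) F)[X] →ₐ[F] (MvPolynomial (Fin σ) F)).comp ψ) =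
        (Algebra.ofId F (MvPolynomial (Fin σ) F)).comp ev := by
      refine MvPolynomial.algHom_ext fun w => ?_
      rcases w with u | j
      · by_cases hu : u ∈ S i
        · simp [ψ, ev, ξ, hu, line, Algebra.ofId_apply]
        · simp [ψ, ev, ξ, hu, Algebra.ofId_apply]
      · simp [ψ, ev, ξ, Algebra.ofId_apply]
    have h2 := DFunLike.congr_fun h1 y
    simpa [Algebra.ofId_apply, Polynomial.coe_aeval_eq_eval] using h2
  have hψb : ∀ j, ψ (b j) = MvPolynomial.aeval (fun v => ξ (Sum.inl (emb j v))) g := fun j => by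
    simp only [ψ, b, kiGenerator, MvPolynomial.aeval_rename]
    rfl
  have hmem : ∀ v, emb i v ∈ S i := fun v => Finset.orderEmbOfFin_mem _ _ _
  have hψbi : ψ (b i) = MvPolynomial.aeval (fun v => line v (pt (Sum.inl (emb i v)))) g := by
    rw [hψb]
    congr 2
    funext v
    simp only [ξ, Sum.elim_inl, dif_pos (hmem v), hidx]
  have hψ1 : (ψ (b i)).eval 1 = g := by
    rw [hψbi]
    have h1 := MvPolynomial.comp_aeval_apply (fun v => line v (pt (Sum.inl (emb i v))))
      ((Polynomial.aeval (1 : (MvPolynomial (Fin σ) F))).restrictScalars F : (MvPolynomial (Fin σ) F)[X] →ₐ[F] (MvPolynomial (Fin σ) F)) g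
    rw [AlgHom.restrictScalars_apply, Polynomial.coe_aeval_eq_eval] at h1
    rw [h1]
    have h2 : (fun v => ((Polynomial.aeval (1 : (MvPolynomial (Fin σ) F))).restrictScalars F : (MvPolynomial (Fin σ) F)[X] →ₐ[F] (MvPolynomial (Fin σ) F))
        (line v (pt (Sum.inl (emb i v))))) = MvPolynomial.X := by
      funext v
      simp [line]
    rw [h2, MvPolynomial.aeval_X_left_apply]
  have eline : ∀ {B'}, 2 ≤ B' → ∀ v x, (mv F (Fin σ)).poly.Easy B' 8 20 (line v x) := by
    intro B' hB' v x
    have e0 : (mv F (Fin σ)).poly.Easy B' 0 0 (algebraMap F (MvPolynomial (Fin σ) F)[X] x) := Easy.const x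
    have e1 : (mv F (Fin σ)).poly.Easy B' 0 0 (C (MvPolynomial.X v)) :=
      (Easy.leaf (Or.inl ⟨v, rfl⟩)).map_C
    refine (Easy.add hB' (δ := 6) (e := 15) (e0.mono hB' (by omega) (by omega)) ?_)
    exact Easy.mul hB' (δ := 4) (e := 10) (Easy.X_poly.mono hB' (by omega) (by omega))
      (Easy.sub hB' e1 e0)
  have hline : ∀ v x, line v x ∈ (mv F (Fin σ)).poly.deg 1 := by
    intro v x
    refine Submodule.add_mem _ ((mv F (Fin σ)).poly.deg_mono 0 1 zero_le_one
      ((mv F (Fin σ)).poly.const_mem_deg x)) ?_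
    rw [Polynomial.algebraMap_apply, ← C_sub, X_mul_C]
    refine mem_poly_deg.2 ⟨(natDegree_C_mul_le _ _).trans natDegree_X_le, fun k => ?_⟩
    rw [coeff_C_mul, coeff_X]
    split_ifs
    · rw [mul_one]
      exact Submodule.sub_mem _ ((mv F (Fin σ)).leaf_deg _ (Or.inl ⟨v, rfl⟩))
        ((mv F (Fin σ)).deg_mono 0 1 zero_le_one ((mv F (Fin σ)).const_mem_deg x))
    · rw [mul_zero]; exact Submodule.zero_mem _
  have hf₁h : p.map (ψ : (MvPolynomial (Fin μ ⊕ Fin n) F) →+* (MvPolynomial (Fin σ) F)[X]) = MvPolynomial.aeval (fun j => (h j).map (ψ : (MvPolynomial (Fin μ ⊕ Fin n) F) →+* (MvPolynomial (Fin σ) F)[X])) f :=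
    MvPolynomial.map_aeval_polynomial h ψ f
  have hcard : ∀ j, j ≠ i → ((Finset.univ : Finset (Fin σ)).filter fun v => emb j v ∈ S i).card < ρ := by
    intro j hj
    refine lt_of_le_of_lt ?_ (hS.card_inter_lt j i hj)
    refine Finset.card_le_card_of_injOn (emb j) (fun v hv => ?_)
      ((S j).orderEmbOfFin (hS.card_eq j)).injective.injOn
    have := (Finset.mem_filter.1 hv).2
    exact Finset.mem_inter.2 ⟨Finset.orderEmbOfFin_mem _ _ _, this⟩
  by_cases hdeg : g.totalDegree = 0
  · exact Or.inl ⟨_, MvPolynomial.totalDegree_eq_zero_iff_eq_C.1 hdeg⟩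
  -- For `ρ > 1` and `d > 0` the power `ρ ^ d` dominates both `d` and `ρ`, so the base `B * ρ ^ d`
  -- suffices.
  rcases Nat.lt_or_ge 1 ρ with hρ | hρ
  · right
    set d := g.totalDegree with hd
    have hρd1 : d < ρ ^ d := Nat.lt_pow_self hρ
    have hρd2 : ρ ≤ ρ ^ d := Nat.le_self_pow hdeg ρ
    set B' := B * ρ ^ d with hB'
    have hle : ρ ^ d ≤ B' := Nat.le_mul_of_pos_left _ (by omega)
    have hBB' : B ≤ B' := Nat.le_mul_of_pos_right _ (by omega)
    have hB2 : 2 ≤ B' := hB.trans hBB'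
    have ef₁ : (mv F (Fin σ)).poly.poly.Easy B' (δ + 17) (e + 42)
        (p.map (ψ : (MvPolynomial (Fin μ ⊕ Fin n) F) →+* (MvPolynomial (Fin σ) F)[X])) := by
      rw [hf₁h]
      refine ((hf.mono_base hBB').algHom hB2 (MvPolynomial.aeval _) (δ' := 16) (e' := 40)
        fun j => ?_).mono hB2 (by omega) (by omega)
      rw [MvPolynomial.aeval_X]
      simp only [hh]
      split_ifs with h1 h2
      · rw [Polynomial.map_C, RingHom.coe_coe, hψb]
        refine Easy.map_C ?_
        refine Easy.aeval_of_const hB2 (δ := 8) (e := 20) _ _ (hcard j h1.ne) (fun v hv => ?_)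
          (fun v hv => ?_) g le_rfl hle (by omega) (by omega)
        · have : emb j v ∉ S i := fun hm => hv (Finset.mem_filter.2 ⟨Finset.mem_univ _, hm⟩)
          exact ⟨_, dif_neg this⟩
        · simp only [ξ, Sum.elim_inl, dif_pos (Finset.mem_filter.1 hv).2]
          exact eline hB2 _ _
      · rw [Polynomial.map_X]
        exact Easy.X_poly.mono hB2 (by omega) (by omega)
      · have : (C (a j)).map (ψ : (MvPolynomial (Fin μ ⊕ Fin n) F) →+* (MvPolynomial (Fin σ) F)[X]) = algebraMap F (MvPolynomial (Fin σ) F)[X][X] (pt (Sum.inr j)) := by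
          rw [Polynomial.map_C, RingHom.coe_coe]
          simp [ψ, a, ξ, Polynomial.algebraMap_apply]
        rw [this]
        exact (Easy.const _).mono hB2 (by omega) (by omega)
    have hψd : (ψ (b i)).natDegree < d + 1 := by
      have h1 := (mv F (Fin σ)).poly.algHom_mem_deg
        (MvPolynomial.aeval fun v => line v (pt (Sum.inl (emb i v)))) (E := 1) (fun v => by
          rw [MvPolynomial.aeval_X]
          exact hline v _) g le_rfl
      rw [← hψbi] at h1
      have h2 := (mem_poly_deg.1 h1).1
      omega
    have er := (Easy.of_isRoot_map hB2 (c := 1) hψ0 hm0 hq hevq hψd (by rw [pow_one]; omega)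
      ef₁).eval_const 1
    rw [map_one, hψ1] at er
    exact (er.mono hB2 (by omega) (by omega)).1
  -- For `ρ ≤ 1` the sets are disjoint: no `b j` with `j < i` moves, the restricted `p` has constant
  -- coefficients, and its root `ψ (b i)` is constant.
  · left
    refine ⟨ev (b i), ?_⟩
    have key := eq_algebraMap_of_isRoot_map hψ0 hm0 hq hevq (by
      have h1 : p.map (ev : (MvPolynomial (Fin μ ⊕ Fin n) F) →+* F) = MvPolynomial.aeval (fun j => (h j).map (ev : (MvPolynomial (Fin μ ⊕ Fin n) F) →+* F)) f :=
        MvPolynomial.map_aeval_polynomial h ev f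
      have h2 : (p.map (ev : (MvPolynomial (Fin μ ⊕ Fin n) F) →+* F)).map (algebraMap F (MvPolynomial (Fin σ) F)[X]) = MvPolynomial.aeval
          (fun j => ((h j).map (ev : (MvPolynomial (Fin μ ⊕ Fin n) F) →+* F)).map (algebraMap F (MvPolynomial (Fin σ) F)[X])) f := by
        rw [h1]
        exact MvPolynomial.map_aeval_polynomial _ (Algebra.ofId F (MvPolynomial (Fin σ) F)[X]) f
      rw [hf₁h, h2]
      congr 2
      funext j
      have hmap : ∀ y, ψ y = algebraMap F (MvPolynomial (Fin σ) F)[X] (ev y) → (C y).map (ψ : (MvPolynomial (Fin μ ⊕ Fin n) F) →+* (MvPolynomial (Fin σ) F)[X]) =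
          ((C y).map (ev : (MvPolynomial (Fin μ ⊕ Fin n) F) →+* F)).map (algebraMap F (MvPolynomial (Fin σ) F)[X]) := fun y hy => by
        simp only [Polynomial.map_C, RingHom.coe_coe, hy]
      simp only [hh]
      split_ifs with h1 h2
      · apply hmap
        have h3 := MvPolynomial.comp_aeval_apply (fun v => pt (Sum.inl (emb j v)))
          (Algebra.ofId F (MvPolynomial (Fin σ) F)[X]) g
        have h4 : ev (b j) = MvPolynomial.aeval (fun v => pt (Sum.inl (emb j v))) g := by
          simp only [ev, b, kiGenerator, MvPolynomial.aeval_rename]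
          rfl
        rw [hψb, h4]
        refine Eq.trans ?_ h3.symm
        congr 2
        funext v
        have h5 := hcard j h1.ne
        have : emb j v ∉ S i := fun hv => by
          have h6 : v ∈ (Finset.univ : Finset (Fin σ)).filter fun v => emb j v ∈ S i :=
            Finset.mem_filter.2 ⟨Finset.mem_univ v, hv⟩
          have := Finset.card_pos.2 ⟨v, h6⟩
          omega
        exact dif_neg this
      · simp
      · apply hmap
        simp [ψ, ev, a, ξ])
    rw [← hψ1, key, Polynomial.algebraMap_apply, eval_C, MvPolynomial.algebraMap_eq]

end GradedLeaves

/-! ### The ring `F[T, x, z]` viewed as `F[x][T][z]` -/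

section Translation

variable {F V : Type*} [Field F]

/-- The identification of `F[T, x, z]` with `F[x][T][z]`. -/
noncomputable def toBivariate :
    MvPolynomial (Option (Option V)) F ≃ₐ[F] (MvPolynomial V F)[X][X] :=
  (MvPolynomial.optionEquivLeft F (Option V)).trans
    (Polynomial.mapAlgEquiv (MvPolynomial.optionEquivLeft F V))

theorem toBivariate_eq_map (P : MvPolynomial (Option (Option V)) F) :
    toBivariate P = (asPolyInZ P).map (MvPolynomial.optionEquivLeft F V :
      MvPolynomial (Option V) F →+* (MvPolynomial V F)[X]) := rfl

theorem coeff_toBivariate (P : MvPolynomial (Option (Option V)) F) (a b : ℕ) (m : V →₀ ℕ) :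
    (((toBivariate P).coeff b).coeff a).coeff m = P.coeff ((m.optionElim a).optionElim b) := by
  rw [toBivariate_eq_map, coeff_map, RingHom.coe_coe, MvPolynomial.optionEquivLeft_coeff_coeff,
    asPolyInZ, MvPolynomial.optionEquivLeft_coeff_coeff]

@[simp]
theorem toBivariate_X_none :
    toBivariate (MvPolynomial.X none : MvPolynomial (Option (Option V)) F) = X := by
  simp [toBivariate_eq_map, asPolyInZ, MvPolynomial.optionEquivLeft_X_none]

@[simp]
theorem toBivariate_X_some_none :
    toBivariate (MvPolynomial.X (some none) : MvPolynomial (Option (Option V)) F) = C X := by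
  simp [toBivariate_eq_map, asPolyInZ, MvPolynomial.optionEquivLeft_X_none,
    MvPolynomial.optionEquivLeft_X_some]

@[simp]
theorem toBivariate_X_some_some (v : V) :
    toBivariate (MvPolynomial.X (some (some v)) : MvPolynomial (Option (Option V)) F) =
      C (C (MvPolynomial.X v)) := by
  simp [toBivariate_eq_map, asPolyInZ, MvPolynomial.optionEquivLeft_X_some]

theorem toBivariate_rename_some (R : MvPolynomial (Option V) F) :
    toBivariate (MvPolynomial.rename some R) = C (MvPolynomial.optionEquivLeft F V R) := by
  have h : ((toBivariate (F := F) (V := V)).toAlgHom.comp (MvPolynomial.rename some)) =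
      Polynomial.CAlgHom.comp (MvPolynomial.optionEquivLeft F V).toAlgHom := by
    refine MvPolynomial.algHom_ext fun v => ?_
    rcases v with _ | v
    · simp [MvPolynomial.optionEquivLeft_X_none]
    · simp [MvPolynomial.optionEquivLeft_X_some]
  exact DFunLike.congr_fun h R

theorem toBivariate_substX {W : Type*} (h : V → MvPolynomial W F)
    (P : MvPolynomial (Option (Option V)) F) :
    toBivariate (substX h P) =
      (toBivariate P).map (mapRingHom (MvPolynomial.aeval h : _ →ₐ[F] MvPolynomial W F)) := by
  let Φ : (MvPolynomial V F)[X][X] →ₐ[F] (MvPolynomial W F)[X][X] :=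
    Polynomial.mapAlgHom (Polynomial.mapAlgHom (MvPolynomial.aeval h))
  have key : ((toBivariate (F := F) (V := W)).toAlgHom.comp (MvPolynomial.aeval
      (fun v : Option (Option V) => match v with
      | none => MvPolynomial.X none
      | some none => MvPolynomial.X (some none)
      | some (some i) => MvPolynomial.rename (fun j : W => some (some j)) (h i)))) =
      Φ.comp (toBivariate (F := F) (V := V)).toAlgHom := by
    refine MvPolynomial.algHom_ext fun v => ?_
    rcases v with _ | _ | v
    · simp [Φ]
    · simp [Φ]
    · have h1 : MvPolynomial.rename (fun j : W => some (some j)) (h v) =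
          MvPolynomial.rename some (MvPolynomial.rename some (h v)) := by
        rw [MvPolynomial.rename_rename]; rfl
      have h2 : MvPolynomial.optionEquivLeft F W (MvPolynomial.rename some (h v)) = C (h v) := by
        have h3 : ((MvPolynomial.optionEquivLeft F W).toAlgHom.comp (MvPolynomial.rename some)) =
            Polynomial.CAlgHom := by
          refine MvPolynomial.algHom_ext fun v => ?_
          simp [MvPolynomial.optionEquivLeft_X_some]
        exact DFunLike.congr_fun h3 (h v)
      have h4 : toBivariate (MvPolynomial.rename (fun j : W => some (some j)) (h v)) =
          C (C (h v)) := by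
        rw [h1, toBivariate_rename_some, h2]
      simpa [Φ] using h4
  exact DFunLike.congr_fun key P

theorem GradedLeaves.easy_toBivariate {B Δ s D : ℕ} {P : MvPolynomial (Option (Option V)) F}
    {K : AlgCircuit F (Option (Option V))} (hK : K.polynomial = P) (hΔ : K.depth ≤ Δ)
    (hKs : K.size ≤ s) (hD : P.totalDegree ≤ D) (hsB : 2 * s + 1 ≤ B) (hDB : D ≤ B) :
    (mv F V).poly.poly.Easy B Δ 1 (toBivariate P) := by
  have hX : ∀ v, toBivariate (MvPolynomial.X v : MvPolynomial (Option (Option V)) F) ∈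
      (mv F V).poly.poly.leaf := by
    rintro (_ | _ | v)
    · rw [toBivariate_X_none]; exact Or.inl rfl
    · rw [toBivariate_X_some_none]; exact Or.inr ⟨X, Or.inl rfl, rfl⟩
    · rw [toBivariate_X_some_some]
      exact Or.inr ⟨_, Or.inr ⟨_, Or.inl ⟨v, rfl⟩, rfl⟩, rfl⟩
  rw [Easy, pow_one]
  refine ⟨?_, ?_⟩
  · rw [← hK]
    refine ((K.hasCircuit.map (A' := (MvPolynomial V F)[X][X]) (toBivariate (F := F) (V := V) :
      MvPolynomial (Option (Option V)) F →+* (MvPolynomial V F)[X][X]) ?_).mono hΔ ((Nat.add_le_add_right (Nat.mul_le_mul_left 2 hKs) 1).trans hsB))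
    rintro _ (⟨v, rfl⟩ | ⟨c, rfl⟩)
    · exact hX v
    · have : toBivariate (MvPolynomial.C c : MvPolynomial (Option (Option V)) F) =
          algebraMap F _ c := toBivariate.commutes c
      rw [RingHom.coe_coe, this]
      exact (mv F V).poly.poly.const_mem_leaf c
  · have := (mv F V).poly.poly.algHom_mem_deg (toBivariate (F := F) (V := V)).toAlgHom (E := 1)
      (fun v => (mv F V).poly.poly.leaf_deg _ (hX v)) P (hD.trans hDB)
    simpa using this

theorem asPolyInZ_pderiv_none (P : MvPolynomial (Option (Option V)) F) :
    asPolyInZ (MvPolynomial.pderiv none P) = derivative (asPolyInZ P) := by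
  unfold asPolyInZ
  induction P using MvPolynomial.induction_on with
  | C c => simp
  | add p q hp hq => simp [hp, hq]
  | mul_X p v hp =>
    rw [Derivation.leibniz, map_mul, derivative_mul, ← hp]
    rcases v with _ | v
    · simp [MvPolynomial.optionEquivLeft_X_none, mul_comm, add_comm]
    · simp [MvPolynomial.optionEquivLeft_X_some, MvPolynomial.pderiv_X_of_ne, mul_comm]

theorem eval_elim_eq (P : MvPolynomial (Option (Option V)) F) (α : F) :
    MvPolynomial.eval (fun v : Option (Option V) => v.elim α fun _ => 0) P =
      ((asPolyInZ P).map (MvPolynomial.constantCoeff : MvPolynomial (Option V) F →+* F)).eval α := by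
  unfold asPolyInZ
  induction P using MvPolynomial.induction_on with
  | C c => simp
  | add p q hp hq => simp [hp, hq]
  | mul_X p v hp =>
    rw [map_mul, hp, map_mul, Polynomial.map_mul, eval_mul]
    rcases v with _ | v
    · simp [MvPolynomial.optionEquivLeft_X_none]
    · simp [MvPolynomial.optionEquivLeft_X_some]

theorem IsNondegenerate.derivative_eval_ne_zero {P : MvPolynomial (Option (Option V)) F}
    {R : MvPolynomial (Option V) F} (h : IsNondegenerate P R) :
    (derivative ((asPolyInZ P).map (MvPolynomial.constantCoeff : MvPolynomial (Option V) F →+* F))).eval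
      (MvPolynomial.constantCoeff R) ≠ 0 := by
  rw [IsNondegenerate, eval_elim_eq, asPolyInZ_pderiv_none, ← derivative_map] at h
  exact h

/-- T-regularity enters the argument through this identity: a monomial free of `T` is free of `x`.
It supplies the constant coefficients at `T = 0` that the residue formula needs. -/
theorem IsTRegularized.map_eval_zero {P : MvPolynomial (Option (Option V)) F}
    (h : IsTRegularized P) : (toBivariate P).map (evalRingHom 0) =
      ((asPolyInZ P).map (MvPolynomial.constantCoeff : MvPolynomial (Option V) F →+* F)).map
        (algebraMap F (MvPolynomial V F)) := by
  classical
  ext b m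
  rw [coeff_map, coeff_map, coeff_map, coe_evalRingHom, ← coeff_zero_eq_eval_zero,
    coeff_toBivariate, MvPolynomial.algebraMap_eq, MvPolynomial.coeff_C,
    MvPolynomial.constantCoeff_eq, asPolyInZ, MvPolynomial.optionEquivLeft_coeff_coeff]
  split_ifs with hm
  · subst hm
    congr 2
    ext v
    rcases v with _ | v <;> simp
  · by_contra hne
    obtain ⟨i, hi⟩ := Finsupp.ne_iff.1 (Ne.symm hm)
    exact h _ (MvPolynomial.mem_support_iff.2 hne) ⟨i, by simpa using hi⟩ (by simp)

theorem IsApproxRoot.dvd_eval_toBivariate {P : MvPolynomial (Option (Option V)) F}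
    {R : MvPolynomial (Option V) F} {k : ℕ} (h : IsApproxRoot P R k) :
    X ^ k ∣ (toBivariate P).eval (MvPolynomial.optionEquivLeft F V R) := by
  have := map_dvd (MvPolynomial.optionEquivLeft F V) h
  rw [map_pow, MvPolynomial.optionEquivLeft_X_none] at this
  rw [toBivariate_eq_map]
  refine this.trans (dvd_of_eq ?_)
  exact (Polynomial.eval_map_apply (f := (MvPolynomial.optionEquivLeft F V :
    MvPolynomial (Option V) F →+* (MvPolynomial V F)[X])) ..).symm

/-- The part of a nondegenerate approximate root that does not depend on `T` is a constant. -/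
theorem IsApproxRoot.eval_zero_eq {P : MvPolynomial (Option (Option V)) F}
    {R : MvPolynomial (Option V) F} {k : ℕ} (hk : 0 < k) (hP : IsTRegularized P)
    (h : IsApproxRoot P R k) (hnd : IsNondegenerate P R) :
    (MvPolynomial.optionEquivLeft F V R).eval 0 =
      algebraMap F (MvPolynomial V F) (MvPolynomial.constantCoeff R) := by
  set p₀ := (asPolyInZ P).map (MvPolynomial.constantCoeff : MvPolynomial (Option V) F →+* F)
  have hnd' := hnd.derivative_eval_ne_zero
  set α := MvPolynomial.constantCoeff R with hα
  set y := (MvPolynomial.optionEquivLeft F V R).eval 0 with hy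
  have hyα : MvPolynomial.constantCoeff y = α := by
    rw [hy, ← coeff_zero_eq_eval_zero, MvPolynomial.constantCoeff_eq,
      MvPolynomial.optionEquivLeft_coeff_coeff, hα, MvPolynomial.constantCoeff_eq]
    congr 1
    ext v
    rcases v with _ | v <;> simp
  have hroot : (p₀.map (algebraMap F (MvPolynomial V F))).eval y = 0 := by
    obtain ⟨u, hu⟩ := h.dvd_eval_toBivariate
    have h1 := congrArg (evalRingHom 0) hu
    rw [← Polynomial.eval_map_apply, hP.map_eval_zero] at h1
    refine Eq.trans h1 ?_
    simp [hk.ne']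
  have hcomp : ∀ p : F[X], MvPolynomial.constantCoeff ((p.map (algebraMap F (MvPolynomial V F))).eval y) =
      p.eval α := by
    intro p
    rw [← Polynomial.eval_map_apply, Polynomial.map_map, hyα]
    congr 1
    have : (MvPolynomial.constantCoeff : MvPolynomial V F →+* F).comp
        (algebraMap F (MvPolynomial V F)) = RingHom.id F := by ext; simp
    rw [this, Polynomial.map_id]
  have hα0 : p₀.IsRoot α := by
    have := hcomp p₀
    rw [hroot, map_zero] at this
    exact this.symm
  -- The root `α` of `p₀` is simple, so `(y - α) * u(y) = 0` in a domain, where `u(y)` has constant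
  -- term `u(α) ≠ 0`.
  obtain ⟨u, hu⟩ := dvd_iff_isRoot.2 hα0
  have huα : u.eval α ≠ 0 := by
    change (derivative p₀).eval α ≠ 0 at hnd'
    rw [hu, derivative_mul] at hnd'
    simpa using hnd'
  rw [hu] at hroot
  simp only [Polynomial.map_mul, Polynomial.map_sub, Polynomial.map_X, Polynomial.map_C, eval_mul,
    eval_sub, eval_X, eval_C, mul_eq_zero] at hroot
  rcases hroot with h1 | h1
  · exact sub_eq_zero.1 h1
  · exact absurd (by rw [← hcomp u, h1, map_zero]) huα

theorem coeff_truncT (Q : MvPolynomial (Option (Option V)) F) (k : ℕ)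
    (m : Option (Option V) →₀ ℕ) :
    (truncT Q k).coeff m = if m (some none) < k then Q.coeff m else 0 := by
  classical
  rw [truncT, MvPolynomial.coeff_sum]
  simp_rw [MvPolynomial.coeff_monomial]
  rw [Finset.sum_ite_eq']
  simp only [Finset.mem_filter, MvPolynomial.mem_support_iff]
  split_ifs with h1 h2 h2
  · rfl
  · exact absurd h1.2 h2
  · by_contra h
    exact h1 ⟨Ne.symm h, h2⟩
  · rfl

theorem coeff_toBivariate_truncRootProduct {l : ℕ} (R : Fin l → MvPolynomial (Option V) F)
    (k b a : ℕ) : ((toBivariate (truncRootProduct R k)).coeff b).coeff a =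
      if a < k then ((∏ i, (X - C (MvPolynomial.optionEquivLeft F V (R i)))).coeff b).coeff a
      else 0 := by
  have h : ∏ i, (X - C (MvPolynomial.optionEquivLeft F V (R i))) =
      toBivariate (∏ i, (MvPolynomial.X none - MvPolynomial.rename some (R i))) := by
    rw [map_prod]
    refine Finset.prod_congr rfl fun i _ => ?_
    rw [map_sub, toBivariate_X_none, toBivariate_rename_some]
  ext m
  rw [coeff_toBivariate, truncRootProduct, coeff_truncT, h]
  split_ifs with h1 h2 h2
  · rw [coeff_toBivariate]
  · simp at h1; omega
  · simp at h1; omega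
  · simp

theorem substX_dvd {W : Type*} (h : V → MvPolynomial W F)
    {P Q : MvPolynomial (Option (Option V)) F} (hQP : Q ∣ P) : substX h Q ∣ substX h P :=
  map_dvd (MvPolynomial.aeval _) hQP

end Translation

/-! ### Circuits of depth zero -/

theorem AlgCircuit.polynomial_of_depth_eq_zero {F V : Type*} [CommSemiring F]
    (K : AlgCircuit F V) (h : K.depth = 0) :
    (∃ v, K.polynomial = MvPolynomial.X v) ∨ ∃ c, K.polynomial = MvPolynomial.C c := by
  have hd : K.nodeDepth K.out = 0 := by
    have := Finset.le_sup (f := K.nodeDepth) (@Finset.mem_univ _ K.fintypeNode K.out)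
    exact Nat.le_zero.1 (this.trans h.le)
  have hin : (K.gate K.out).inputs = 0 := by
    refine Multiset.eq_zero_of_forall_notMem fun u hu => ?_
    rw [K.nodeDepth_eq] at hd
    have := Multiset.le_sup (Multiset.mem_map_of_mem (fun u => K.nodeDepth u + 1) hu)
    omega
  have hv := K.value_eq K.out
  rcases hg : K.gate K.out with x | c | s | s <;> rw [hg] at hv hin
  · exact Or.inl ⟨x, hv⟩
  · exact Or.inr ⟨c, hv⟩
  · change s = 0 at hin
    subst hin
    exact Or.inr ⟨0, by rw [map_zero]; exact hv⟩
  · change s = 0 at hin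
    subst hin
    exact Or.inr ⟨1, by rw [map_one]; exact hv⟩

/-- For a variable or a constant `P`, the substitution does not create divisibility. -/
theorem truncRootProduct_dvd_of_depth_eq_zero {F V W : Type*} [Field F] {k l : ℕ}
    {P : MvPolynomial (Option (Option V)) F} {R : Fin l → MvPolynomial (Option V) F}
    {K : AlgCircuit F (Option (Option V))} (hK : K.polynomial = P) (hd : K.depth = 0)
    (hk : 0 < k) (hmon : IsMonicInZ P)
    (hR : ∀ i, IsApproxRoot P (R i) k ∧ IsTruncated (R i) k ∧ IsNondegenerate P (R i))
    (h : V → MvPolynomial W F) (hdvd : substX h (truncRootProduct R k) ∣ substX h P) :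
    truncRootProduct R k ∣ P := by
  rw [← map_dvd_iff (toBivariate (F := F) (V := V))]
  rw [← map_dvd_iff (toBivariate (F := F) (V := W)), toBivariate_substX, toBivariate_substX] at hdvd
  have hQ := coeff_toBivariate_truncRootProduct R k
  rcases K.polynomial_of_depth_eq_zero hd with ⟨v, hv⟩ | ⟨c, hc⟩
  · obtain rfl := hK.symm.trans hv
    rcases v with _ | v
    -- For `P = z` the roots are `0` modulo `T ^ k`, hence `0`. Then `Q = z ^ l`, and divisibility
    -- means `l ≤ 1` before and after the substitution.
    · have hR0 : ∀ i, MvPolynomial.optionEquivLeft F V (R i) = 0 := fun i => by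
        have h1 := (hR i).1.dvd_eval_toBivariate
        rw [toBivariate_X_none, eval_X, X_pow_dvd_iff] at h1
        have h2 : (MvPolynomial.optionEquivLeft F V (R i)).natDegree < k := by
          rw [MvPolynomial.natDegree_optionEquivLeft]; exact (hR i).2.1
        ext1 a
        rw [coeff_zero]
        rcases Nat.lt_or_ge a k with ha | ha
        · exact h1 a ha
        · exact coeff_eq_zero_of_natDegree_lt (by omega)
      have hQX : toBivariate (truncRootProduct R k) = X ^ l := by
        ext1 b
        ext1 a
        have hprod : ∏ i, (X - C (MvPolynomial.optionEquivLeft F V (R i))) = X ^ l := by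
          have h1 : ∀ i, X - C (MvPolynomial.optionEquivLeft F V (R i)) = X := fun i => by
            rw [hR0 i, C_0]; exact sub_zero (X : (MvPolynomial V F)[X][X])
          simp [h1]
        rw [hQ, hprod, coeff_X_pow]
        split_ifs with h1 h2 h2
        · rfl
        · rfl
        · rw [coeff_one, if_neg (by omega)]
        · rfl
      rw [hQX, toBivariate_X_none] at hdvd ⊢
      rw [Polynomial.map_pow, Polynomial.map_X, X_pow_dvd_iff] at hdvd
      have hl : l ≤ 1 := by
        by_contra hl
        have := hdvd 1 (by omega)
        simp at this
      simpa using pow_dvd_pow (X : (MvPolynomial V F)[X][X]) hl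
    -- Neither `T` nor any `x_i` is monic in `z`.
    · exfalso
      obtain ⟨c, -, hc⟩ := hmon
      rw [asPolyInZ, MvPolynomial.optionEquivLeft_X_some, leadingCoeff_C] at hc
      have := congrArg MvPolynomial.totalDegree hc
      simp at this
  · obtain rfl := hK.symm.trans hc
    -- A constant has zero derivative, so it has no non-degenerate roots and `Q = 1`.
    have : IsEmpty (Fin l) := ⟨fun i => (hR i).2.2 (by simp)⟩
    have hQ1 : toBivariate (truncRootProduct R k) = 1 := by
      ext1 b
      ext1 a
      rw [hQ, Finset.univ_eq_empty, Finset.prod_empty, coeff_one]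
      split_ifs with h1 h2 h2
      · rfl
      · rfl
      · rw [coeff_one, if_neg (by omega)]
      · rfl
    rw [hQ1]
    exact one_dvd _

/-! ### Assembly -/

/-- If the generator makes `P` divisible by the truncated product of its approximate roots, although
it is not, then the seed polynomial of the generator is easy. -/
theorem exists_exponent_hasCircuit_of_substX_dvd :
    ∃ M : ℕ, ∀ (F : Type*) [Field F] [CharZero F] (n σ μ ρ k l s Δ : ℕ)
      (P : MvPolynomial (Option (Option (Fin n))) F)
      (R : Fin l → MvPolynomial (Option (Fin n)) F) (g : MvPolynomial (Fin σ) F)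
      (S : Fin n → Finset (Fin μ)) (hS : IsDesign n σ μ ρ S), 0 < k →
      (∃ C : AlgCircuit F (Option (Option (Fin n))),
        C.polynomial = P ∧ C.depth ≤ Δ ∧ C.size ≤ s) →
      IsTRegularized P →
      (∀ i, IsApproxRoot P (R i) k ∧ IsTruncated (R i) k ∧ IsNondegenerate P (R i)) →
      ¬ truncRootProduct R k ∣ P →
      substX (kiGenerator g S hS) (truncRootProduct R k) ∣ substX (kiGenerator g S hS) P →
      (∃ c, g = MvPolynomial.C c) ∨ HasCircuit (Set.range MvPolynomial.X ∪ Set.range MvPolynomial.C)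
        (Δ + 157) (((2 * (s + l + k + P.totalDegree) + 2) * ρ ^ g.totalDegree) ^ M) g := by
  -- The exponent from `exists_easy_of_not_dvd` with `c = 1` and input exponent `1`, since the base
  -- `B` chosen below exceeds `k`, `l`, `2 * s + 1` and `deg P`.
  obtain ⟨e, he⟩ : ∃ e, e = 328 * 1 + 776 * 1 + 9990 := ⟨_, rfl⟩
  refine ⟨48 * e + 2619, ?_⟩
  intro F _ _ n σ μ ρ k l s Δ P R g S hS hk hC hreg hR hQP hdvd
  obtain ⟨K, hK, hKd, hKs⟩ := hC
  set B := 2 * (s + l + k + P.totalDegree) + 2 with hB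
  rw [← map_dvd_iff (toBivariate (F := F) (V := Fin n))] at hQP
  rw [← map_dvd_iff (toBivariate (F := F) (V := Fin μ)), toBivariate_substX,
    toBivariate_substX] at hdvd
  obtain ⟨f, hf0, hfe, hf⟩ := GradedLeaves.exists_easy_of_not_dvd (B := B) (c := 1) (by omega)
    (GradedLeaves.easy_toBivariate hK hKd hKs le_rfl (B := B) (by omega) (by omega))
    hk (by rw [pow_one]; omega) (by rw [pow_one]; omega) hreg.map_eval_zero
    (fun i => (hR i).1.eval_zero_eq hk hreg (hR i).2.2)
    (fun i => (hR i).1.dvd_eval_toBivariate)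
    (fun i => by rw [MvPolynomial.natDegree_optionEquivLeft]; exact (hR i).2.1)
    (fun i => (hR i).2.2.derivative_eval_ne_zero)
    (coeff_toBivariate_truncRootProduct R k) hQP
  rw [← he] at hfe
  exact hfe.exists_C_or_hasCircuit_of_aeval_kiGenerator_eq_zero (by omega) hf0 g S hS
    (hf _ _ hdvd)

end SeedCircuit

theorem theorem8p11 :
    ∃ (c : ℕ) (p : MvPolynomial (Fin 4) ℕ) (q : Polynomial ℕ),
      ∀ (F : Type*) [Field F] [CharZero F] (n σ μ ρ k l s Δ d : ℕ)
        (P Q : MvPolynomial (Option (Option (Fin n))) F)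
        (R : Fin l → MvPolynomial (Option (Fin n)) F)
        (g : MvPolynomial (Fin σ) F)
        (S : Fin n → Finset (Fin μ)) (hS : IsDesign n σ μ ρ S) (s' : ℝ),
        2 ≤ n → 1 < k →
        (∃ C : AlgCircuit F (Option (Option (Fin n))),
          C.polynomial = P ∧ C.depth ≤ Δ ∧ C.size ≤ s) →
        IsTRegularized P → IsMonicInZ P →
        (∀ i, IsApproxRoot P (R i) k ∧ IsTruncated (R i) k ∧ IsNondegenerate P (R i)) →
        Q = truncRootProduct R k →
        g.totalDegree = d →
        s' = (MvPolynomial.eval ![s, l, k, P.totalDegree] p : ℕ) *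
          ((ρ : ℝ) * Real.logb 2 k) ^ (q.eval d) →
        (¬ Q ∣ P → substX (kiGenerator g S hS) Q ∣ substX (kiGenerator g S hS) P →
          ∃ C : AlgCircuit F (Fin σ), C.polynomial = g ∧ C.depth ≤ c * Δ ∧ (C.size : ℝ) ≤ s') ∧
        ((∀ C : AlgCircuit F (Fin σ), C.polynomial = g → C.depth ≤ c * Δ → s' < (C.size : ℝ)) →
          (Q ∣ P ↔ substX (kiGenerator g S hS) Q ∣ substX (kiGenerator g S hS) P)) := by
  obtain ⟨M, hM⟩ := exists_exponent_hasCircuit_of_substX_dvd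
  refine ⟨158, (2 * (MvPolynomial.X 0 + MvPolynomial.X 1 + MvPolynomial.X 2 + MvPolynomial.X 3)
    + 2) ^ M, Polynomial.C M * Polynomial.X, ?_⟩
  intro F _ _ n σ μ ρ k l s Δ d P Q R g S hS s' _ hk hC hreg hmon hR hQ hd hs'
  subst hQ hd
  -- The circuit needs no logarithmic factor; since `k ≥ 2`, the factor in `s'` only enlarges the
  -- bound.
  have hlog : 1 ≤ Real.logb 2 k := by
    rw [Real.le_logb_iff_rpow_le one_lt_two (by positivity), Real.rpow_one]
    exact_mod_cast hk
  have hs'' : (((2 * (s + l + k + P.totalDegree) + 2) * ρ ^ g.totalDegree) ^ M : ℕ) ≤ s' := by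
    have he : MvPolynomial.eval ![s, l, k, P.totalDegree] ((2 * (MvPolynomial.X 0 +
        MvPolynomial.X 1 + MvPolynomial.X 2 + MvPolynomial.X 3) + 2) ^ M) =
        (2 * (s + l + k + P.totalDegree) + 2) ^ M := by
      simp
    rw [hs', he, Polynomial.eval_mul, Polynomial.eval_C, Polynomial.eval_X, mul_pow, Nat.cast_mul,
      ← pow_mul, mul_comm g.totalDegree, Nat.cast_pow ρ]
    refine mul_le_mul_of_nonneg_left (pow_le_pow_left₀ (Nat.cast_nonneg _) ?_ _) (Nat.cast_nonneg _)
    exact le_mul_of_one_le_right (Nat.cast_nonneg _) hlog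
  have main : ¬ truncRootProduct R k ∣ P →
      substX (kiGenerator g S hS) (truncRootProduct R k) ∣ substX (kiGenerator g S hS) P →
      ∃ C : AlgCircuit F (Fin σ), C.polynomial = g ∧ C.depth ≤ 158 * Δ ∧ (C.size : ℝ) ≤ s' := by
    intro hQP hdvd
    have hs0 : 0 ≤ s' := (Nat.cast_nonneg _).trans hs''
    -- Positivity of `Δ` is what lets `158 * Δ` absorb the additive depth 157.
    have hΔ : 0 < Δ := by
      rw [Nat.pos_iff_ne_zero]
      rintro rfl
      obtain ⟨K, hK, hKd, -⟩ := hC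
      exact hQP (truncRootProduct_dvd_of_depth_eq_zero hK (Nat.le_zero.1 hKd) (by omega) hmon hR _
        hdvd)
    rcases hM F n σ μ ρ k l s Δ P R g S hS (by omega) hC hreg hR hQP hdvd with ⟨c, hc⟩ | h
    · obtain ⟨K, hK, hKd, hKs⟩ := AlgCircuit.exists_of_hasCircuit (F := F) (V := Fin σ)
        (f := MvPolynomial.C c) (HasCircuit.leaf (Or.inr ⟨c, rfl⟩))
      refine ⟨K, hK.trans hc.symm, hKd.trans (Nat.zero_le _), le_trans ?_ hs''⟩
      refine (Nat.cast_le.2 hKs).trans (Nat.cast_le.2 (Nat.one_le_pow _ _ ?_))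
      rw [hc, MvPolynomial.totalDegree_C, pow_zero]
      omega
    · obtain ⟨K, hK, hKd, hKs⟩ := AlgCircuit.exists_of_hasCircuit h
      exact ⟨K, hK, by omega, le_trans (by exact_mod_cast hKs) hs''⟩
  refine ⟨main, fun hhard => ⟨substX_dvd _, fun hdvd => ?_⟩⟩
  by_contra hQP
  obtain ⟨K, hK, hKd, hKs⟩ := main hQP hdvd
  exact absurd hKs (not_le.2 (hhard K hK hKd))
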